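/- Let $d\ge 1$ be an integer, $R>0$, let $B_R\subset\mathbb{R}^d$ be the open ball of radius $R$ centred at $0$, and let $|E|$ denote the Lebesgue measure of a set $E\subset\mathbb{R}^d$. Let $u\in H^1(B_R)$ be real-valued, i.e. $u\in L^2(B_R)$ has a weak gradient $\nabla u\in L^2(B_R;\mathbb{R}^d)$. Then for all $(k,l)\in\mathbb{R}^2$ with $k\le l$, the function $(u-k)_+=\max(u-k,0)$ belongs to $H^1(B_R)$, and its weak gradient $\nabla(u-k)_+$ satisfies $$(l-k)\,\big|\{u\le k\}\cap B_R\big|\,\big|\{u\ge l\}\cap B_R\big|\;\le\; R\,|B_R|\,\big|\{k<u<l\}\cap B_R\big|^{1/2}\,\Big(\int_{B_R}|\nabla(u-k)_+(x)|^2\,\mathrm{d}x\Big)^{1/2}.$$ -/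

import Mathlib

open MeasureTheory
open scoped ContDiff

/-- `G` is a weak gradient of `u` on the open set `Ω`: both are locally integrable on `Ω` and
`∫_Ω u ∂ᵢφ = - ∫_Ω Gᵢ φ` for all test functions `φ ∈ C_c^∞(Ω)` and all coordinates `i`. -/
def HasWeakGradientOn {d : ℕ} (u : EuclideanSpace ℝ (Fin d) → ℝ)
    (G : EuclideanSpace ℝ (Fin d) → EuclideanSpace ℝ (Fin d))
    (Ω : Set (EuclideanSpace ℝ (Fin d))) : Prop :=
  LocallyIntegrableOn u Ω volume ∧ LocallyIntegrableOn G Ω volume ∧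
    ∀ φ : EuclideanSpace ℝ (Fin d) → ℝ,
      ContDiff ℝ ∞ φ → HasCompactSupport φ → tsupport φ ⊆ Ω →
        ∀ i : Fin d,
          ∫ x in Ω, u x * fderiv ℝ φ x (EuclideanSpace.single i 1) =
            -∫ x in Ω, G x i * φ x

/-- `u` (a representative) belongs to the Sobolev space `H¹(Ω)`: `u ∈ L²(Ω)` and `u` has a
weak gradient on `Ω` that is in `L²(Ω)`. -/
def MemH1 {d : ℕ} (u : EuclideanSpace ℝ (Fin d) → ℝ)
    (Ω : Set (EuclideanSpace ℝ (Fin d))) : Prop :=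
  MemLp u 2 (volume.restrict Ω) ∧
    ∃ G : EuclideanSpace ℝ (Fin d) → EuclideanSpace ℝ (Fin d),
      HasWeakGradientOn u G Ω ∧ MemLp G 2 (volume.restrict Ω)

/-!
The heart of the proof is the Poincaré inequality
`∬ |f y - f x| ≤ 2 R |B_R| ∫ |∇f|` over `B_R × B_R` for `C¹` functions, with a constant independent
of the dimension. Let `Z`, `W` be independent standard Gaussian vectors in `ℝᵈ × ℂ`. The path
`cos t • Z + sin t • W`, `0 ≤ t ≤ π / 2`, joins them, and at each time its position and velocity are
again independent standard Gaussians; integrating along it bounds `𝔼 |F W - F Z|` by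
`π / 2 * 𝔼 |∇F Z|`. By Archimedes' theorem the `ℝᵈ`-component of `R Z / |Z|` is uniformly
distributed in `B_R`, so this applies to `F z = f (R z / |z|)`, whose gradient costs a factor
`R / |Z|`, with `|Z|` independent of `Z / |Z|` and `𝔼 (1 / |Z|) ≤ 1`.

Mollification extends the inequality to functions with a weak gradient. Apply it to
`w = min (u - k)₊ (l - k)`. On pairs with one point in `{u ≤ k}` and the other in `{l ≤ u}`, in
either order, `|w y - w x| = l - k`, so the left side is at least `2 (l - k) |{u ≤ k}| |{l ≤ u}|`.
Since `∇w` is `∇u` on `{k < u < l}` and vanishes elsewhere, Cauchy–Schwarz concludes.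
-/

section Gaussian

open ProbabilityTheory Module Real ENNReal Set

variable {H : Type*} [NormedAddCommGroup H] [InnerProductSpace ℝ H]

theorem enorm_sub_le_lintegral_fderiv_rotation {F : H → ℝ} (hF : ContDiffOn ℝ 1 F {0}ᶜ)
    {z w : H} (hzw : LinearIndependent ℝ ![z, w]) :
    ‖F w - F z‖ₑ ≤ ∫⁻ t in Icc 0 (π / 2),
      ‖fderiv ℝ F (cos t • z + sin t • w) (-sin t • z + cos t • w)‖ₑ := by
  set c : ℝ → H := fun t => cos t • z + sin t • w with hc
  have hc' : ∀ t, HasDerivAt c (-sin t • z + cos t • w) t := fun t =>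
    ((hasDerivAt_cos t).smul_const z).add ((hasDerivAt_sin t).smul_const w)
  have h0 : ∀ t, c t ≠ 0 := fun t ht => by
    obtain ⟨hcos, hsin⟩ := LinearIndependent.pair_iff.1 hzw _ _ ht
    simpa [hcos, hsin] using sin_sq_add_cos_sq t
  have hFc : ContDiff ℝ 1 (F ∘ c) := by
    have : ContDiff ℝ 1 c := by fun_prop
    exact contDiffOn_univ.1 (hF.comp this.contDiffOn fun t _ => h0 t)
  have hderiv : ∀ t, deriv (F ∘ c) t = fderiv ℝ F (c t) (-sin t • z + cos t • w) := fun t =>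
    (((hF.contDiffAt (isOpen_compl_singleton.mem_nhds (h0 t))).differentiableAt
      one_ne_zero).hasFDerivAt.comp_hasDerivAt t (hc' t)).deriv
  calc ‖F w - F z‖ₑ = ‖(F ∘ c) (π / 2) - (F ∘ c) 0‖ₑ := by simp [hc]
    _ ≤ ∫⁻ t in Icc 0 (π / 2), ‖deriv (F ∘ c) t‖ₑ :=
        enorm_sub_le_lintegral_deriv_of_contDiffOn_Icc hFc.contDiffOn (by positivity)
    _ = _ := by simp_rw [hderiv]; rfl

variable [FiniteDimensional ℝ H] [MeasurableSpace H] [BorelSpace H]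

theorem integrable_exp_neg_norm_sq_div_two :
    Integrable fun z : H => exp (-‖z‖ ^ 2 / 2) := by
  have h := (GaussianFourier.integrable_cexp_neg_mul_sq_norm_add (V := H) (b := 1 / 2)
    (by norm_num) 0 0).re
  refine h.congr (.of_forall fun z => ?_)
  dsimp only
  rw [zero_mul, add_zero, show -(1 / 2 : ℂ) * ‖z‖ ^ 2 = ((-‖z‖ ^ 2 / 2 : ℝ) : ℂ) by push_cast; ring]
  exact Complex.exp_ofReal_re _

theorem stdGaussian_eq_withDensity :
    stdGaussian H = volume.withDensity fun z =>
      ENNReal.ofReal ((2 * π) ^ (-(finrank ℝ H / 2 : ℝ)) * exp (-‖z‖ ^ 2 / 2)) := by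
  set c : ℝ := (2 * π) ^ (-(finrank ℝ H / 2 : ℝ))
  have : IsFiniteMeasure (volume.withDensity fun z : H =>
      ENNReal.ofReal (c * exp (-‖z‖ ^ 2 / 2))) :=
    isFiniteMeasure_withDensity_ofReal (integrable_exp_neg_norm_sq_div_two.const_mul c).2
  have hnorm : (c : ℂ) * ((π : ℂ) / (1 / 2)) ^ ((finrank ℝ H : ℂ) / 2) = 1 := by
    rw [show (π : ℂ) / (1 / 2) = ((2 * π : ℝ) : ℂ) by push_cast; ring,
      show (finrank ℝ H : ℂ) / 2 = ((finrank ℝ H / 2 : ℝ) : ℂ) by push_cast; ring,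
      ← Complex.ofReal_cpow (by positivity), ← Complex.ofReal_mul,
      ← Real.rpow_add (by positivity), neg_add_cancel, Real.rpow_zero, Complex.ofReal_one]
  refine Measure.ext_of_charFun (funext fun t => ?_)
  calc charFun (stdGaussian H) t
      = c * ∫ z : H, Complex.exp (-(1 / 2) * ‖z‖ ^ 2 + Complex.I * inner ℝ t z) := by
        rw [GaussianFourier.integral_cexp_neg_mul_sq_norm_add (by norm_num), ← mul_assoc, hnorm,
          one_mul, charFun_stdGaussian, Complex.I_sq]
        ring_nf
    _ = charFun (volume.withDensity fun z => ENNReal.ofReal (c * exp (-‖z‖ ^ 2 / 2))) t := by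
        rw [charFun_apply, integral_withDensity_eq_integral_toReal_smul (by fun_prop) (by simp),
          ← integral_const_mul]
        refine integral_congr_ae (.of_forall fun z => ?_)
        dsimp only
        rw [toReal_ofReal (by positivity), real_inner_comm, Complex.real_smul, Complex.exp_add]
        push_cast
        ring_nf

theorem stdGaussian_absolutelyContinuous : stdGaussian H ≪ (volume : Measure H) := by
  rw [stdGaussian_eq_withDensity]
  exact withDensity_absolutelyContinuous _ _

theorem ae_linearIndependent_pair (μ : Measure H) [μ.IsAddHaarMeasure] (hH : 1 < finrank ℝ H) :
    ∀ᵐ p ∂μ.prod μ, LinearIndependent ℝ ![p.1, p.2] := by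
  have hopen : IsOpen {p : H × H | LinearIndependent ℝ ![p.1, p.2]} :=
    isOpen_setOfPred_linearIndependent.preimage (by fun_prop)
  have : Nontrivial H := nontrivial_of_finrank_pos (zero_lt_one.trans hH)
  rw [Measure.ae_prod_iff_ae_ae hopen.measurableSet]
  filter_upwards [Measure.ae_ne μ 0] with z hz
  have hspan : Submodule.span ℝ {z} ≠ ⊤ := fun h => by
    rw [← finrank_top ℝ H, ← h, finrank_span_singleton hz] at hH
    exact hH.false
  filter_upwards [measure_eq_zero_iff_ae_notMem.1 (Measure.addHaar_submodule μ _ hspan)] with w hw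
  rw [LinearIndependent.pair_iff' hz]
  exact fun a h => hw (Submodule.mem_span_singleton.2 ⟨a, h⟩)

theorem lintegral_enorm_dual_stdGaussian_le (L : StrongDual ℝ H) :
    ∫⁻ z, ‖L z‖ₑ ∂stdGaussian H ≤ ‖L‖ₑ := by
  have hL : MemLp L 2 (stdGaussian H) := IsGaussian.memLp_dual _ L 2 (by simp)
  have hsq : ∫ z, ‖L z‖ ^ 2 ∂stdGaussian H = ‖L‖ ^ 2 := by
    rw [← variance_dual_stdGaussian, variance_of_integral_eq_zero (by fun_prop)
      (integral_strongDual_stdGaussian L)]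
    simp
  have hvar : (∫ z, ‖L z‖ ∂stdGaussian H) ^ 2 ≤ ‖L‖ ^ 2 := by
    have := variance_nonneg (fun z => ‖L z‖) (stdGaussian H)
    rw [variance_eq_sub hL.norm] at this
    exact hsq ▸ sub_nonneg.1 this
  rw [← ofReal_integral_norm_eq_lintegral_enorm (hL.integrable (by simp)), ← ofReal_norm]
  exact ofReal_le_ofReal (le_of_sq_le_sq hvar (norm_nonneg L))

theorem lintegral_prod_stdGaussian_enorm_sub_le (hH : 1 < finrank ℝ H) {F : H → ℝ}
    (hF : ContDiffOn ℝ 1 F {0}ᶜ) :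
    ∫⁻ p, ‖F p.2 - F p.1‖ₑ ∂(stdGaussian H).prod (stdGaussian H) ≤
      ENNReal.ofReal (π / 2) * ∫⁻ z, ‖fderiv ℝ F z‖ₑ ∂stdGaussian H := by
  set γ := stdGaussian H
  have hrot : ∀ t, MeasurePreserving (ContinuousLinearMap.rotation t) (γ.prod γ) (γ.prod γ) :=
    fun t => ⟨by fun_prop, IsGaussian.map_rotation_eq_self integral_id_stdGaussian t⟩
  have hΦ : Measurable fun p : H × H => ‖fderiv ℝ F p.1 p.2‖ₑ :=
    (isBoundedBilinearMap_apply.continuous.measurable.comp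
      (((measurable_fderiv ℝ F).comp measurable_fst).prodMk measurable_snd)).enorm
  calc ∫⁻ p, ‖F p.2 - F p.1‖ₑ ∂γ.prod γ
      ≤ ∫⁻ p, (∫⁻ t in Icc 0 (π / 2), ‖fderiv ℝ F (ContinuousLinearMap.rotation t p).1
          (ContinuousLinearMap.rotation t p).2‖ₑ) ∂γ.prod γ := by
        refine lintegral_mono_ae ?_
        have hac : γ ≪ (volume : Measure H) := stdGaussian_absolutelyContinuous
        have hae := (hac.prod hac).ae_le (ae_linearIndependent_pair volume hH)
        filter_upwards [hae] with p hp using enorm_sub_le_lintegral_fderiv_rotation hF hp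
    _ = ∫⁻ t in Icc 0 (π / 2), ∫⁻ p, ‖fderiv ℝ F (ContinuousLinearMap.rotation t p).1
          (ContinuousLinearMap.rotation t p).2‖ₑ ∂γ.prod γ := by
        refine lintegral_lintegral_swap (Measurable.aemeasurable ?_)
        exact hΦ.comp (f := fun x : (H × H) × ℝ => ContinuousLinearMap.rotation x.2 x.1)
          (by simp only [ContinuousLinearMap.rotation_apply]; fun_prop)
    _ = ENNReal.ofReal (π / 2) * ∫⁻ z, ∫⁻ w, ‖fderiv ℝ F z w‖ₑ ∂γ ∂γ := by
        simp_rw [fun t => (hrot t).lintegral_comp hΦ]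
        rw [lintegral_prod _ hΦ.aemeasurable, setLIntegral_const, Real.volume_Icc, sub_zero,
          mul_comm]
    _ ≤ _ := by gcongr; exact lintegral_enorm_dual_stdGaussian_le _

theorem integral_comp_norm_stdGaussian [Nontrivial H] (g : ℝ → ℝ) :
    ∫ z, g ‖z‖ ∂stdGaussian H = (2 * π) ^ (-(finrank ℝ H / 2 : ℝ)) *
      (finrank ℝ H * volume.real (Metric.ball (0 : H) 1) *
        ∫ r in Ioi 0, r ^ (finrank ℝ H - 1) * (exp (-r ^ 2 / 2) * g r)) := by
  rw [stdGaussian_eq_withDensity, integral_withDensity_eq_integral_toReal_smul (by fun_prop)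
    (by simp)]
  have h := integral_fun_norm_addHaar (volume : Measure H) fun r => exp (-r ^ 2 / 2) * g r
  simp only [nsmul_eq_mul, smul_eq_mul, ← mul_assoc] at h ⊢
  simp only [mul_assoc] at h ⊢
  rw [← h, ← integral_const_mul]
  refine integral_congr_ae (.of_forall fun z => ?_)
  dsimp only
  rw [toReal_ofReal (by positivity), mul_assoc]

theorem integral_pow_add_two_mul_exp_neg_sq_div_two (n : ℕ) :
    ∫ r in Ioi (0 : ℝ), r ^ (n + 2) * exp (-r ^ 2 / 2) =
      (n + 1) * ∫ r in Ioi (0 : ℝ), r ^ n * exp (-r ^ 2 / 2) := by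
  have hGamma : ∀ k : ℕ, ∫ r in Ioi (0 : ℝ), r ^ k * exp (-r ^ 2 / 2) =
      (1 / 2) ^ (-(k + 1 : ℝ) / 2) * (1 / 2) * Real.Gamma ((k + 1) / 2) := fun k => by
    rw [← integral_rpow_mul_exp_neg_mul_rpow two_pos
      (neg_one_lt_zero.trans_le k.cast_nonneg) one_half_pos]
    simp only [Real.rpow_natCast, Real.rpow_ofNat]
    ring_nf
  rw [hGamma, hGamma, show ((n + 2 : ℕ) + 1 : ℝ) / 2 = (n + 1) / 2 + 1 by push_cast; ring,
    Real.Gamma_add_one (by positivity),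
    show -((n + 2 : ℕ) + 1 : ℝ) / 2 = -(n + 1) / 2 - 1 by push_cast; ring,
    Real.rpow_sub_one (by norm_num)]
  ring

theorem integral_inv_norm_sq_stdGaussian (hH : 3 ≤ finrank ℝ H) :
    ∫ z, (‖z‖ ^ 2)⁻¹ ∂stdGaussian H = (finrank ℝ H - 2 : ℝ)⁻¹ := by
  obtain ⟨n, hn⟩ : ∃ n, finrank ℝ H = n + 3 := ⟨_, (Nat.sub_add_cancel hH).symm⟩
  have : Nontrivial H := nontrivial_of_finrank_pos (R := ℝ) (by omega)
  have hmass := integral_comp_norm_stdGaussian (H := H) fun _ => 1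
  have hinv := integral_comp_norm_stdGaussian (H := H) fun r => (r ^ 2)⁻¹
  have hcancel : ∫ r in Ioi (0 : ℝ), r ^ (n + 3 - 1) * (exp (-r ^ 2 / 2) * (r ^ 2)⁻¹) =
      ∫ r in Ioi (0 : ℝ), r ^ n * exp (-r ^ 2 / 2) :=
    setIntegral_congr_fun measurableSet_Ioi fun r (hr : 0 < r) => by
      simp only [show n + 3 - 1 = n + 2 by omega]
      field_simp
      ring
  simp only [integral_const, probReal_univ, smul_eq_mul, mul_one, hn,
    show n + 3 - 1 = n + 2 by omega, integral_pow_add_two_mul_exp_neg_sq_div_two] at hmass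
  rw [hn, hcancel] at hinv
  refine hinv.trans (_root_.eq_inv_of_mul_eq_one_left (Eq.trans ?_ hmass.symm))
  rw [hn]
  push_cast
  ring

theorem lintegral_inv_norm_stdGaussian_le_one (hH : 3 ≤ finrank ℝ H) :
    ∫⁻ z, ENNReal.ofReal ‖z‖⁻¹ ∂stdGaussian H ≤ 1 := by
  have hn : (1 : ℝ) ≤ finrank ℝ H - 2 := by
    have : (3 : ℝ) ≤ finrank ℝ H := by exact_mod_cast hH
    linarith
  have hsq := integral_inv_norm_sq_stdGaussian hH
  have hint : Integrable (fun z : H => (‖z‖ ^ 2)⁻¹) (stdGaussian H) :=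
    .of_integral_ne_zero (by rw [hsq]; positivity)
  have hsum : Integrable (fun z : H => (1 + (‖z‖ ^ 2)⁻¹) / 2) (stdGaussian H) :=
    ((integrable_const 1).add hint).div_const 2
  calc ∫⁻ z, ENNReal.ofReal ‖z‖⁻¹ ∂stdGaussian H
      ≤ ∫⁻ z, ENNReal.ofReal ((1 + (‖z‖ ^ 2)⁻¹) / 2) ∂stdGaussian H := by
        refine lintegral_mono fun z => ofReal_le_ofReal ?_
        rw [← inv_pow]
        linarith [sq_nonneg (‖z‖⁻¹ - 1)]
    _ = ENNReal.ofReal ((1 + (finrank ℝ H - 2 : ℝ)⁻¹) / 2) := by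
        rw [← ofReal_integral_eq_lintegral_ofReal hsum (.of_forall fun z => by positivity),
          integral_div, integral_add (integrable_const 1) hint, hsq]
        simp
    _ ≤ 1 := ofReal_le_one.2 (by linarith [inv_le_one_of_one_le₀ hn])

end Gaussian

section Radial

open ProbabilityTheory Module Real ENNReal Set Metric

theorem hasFDerivAt_inv_norm_smul {H : Type*} [NormedAddCommGroup H] [InnerProductSpace ℝ H] {z : H}
    (hz : z ≠ 0) :
    HasFDerivAt (fun z : H => ‖z‖⁻¹ • z) (‖z‖⁻¹ • (ℝ ∙ z)ᗮ.starProjection) z := by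
  have hz' : ‖z‖ ≠ 0 := norm_ne_zero_iff.2 hz
  have hnorm : HasFDerivAt (fun x : H => ‖x‖) (‖z‖⁻¹ • innerSL ℝ z) z := by
    have := (hasStrictFDerivAt_norm_sq z).hasFDerivAt.sqrt (pow_ne_zero 2 hz')
    simp only [Real.sqrt_sq (norm_nonneg _)] at this
    convert this using 1
    module
  refine (((hasDerivAt_inv hz').comp_hasFDerivAt z hnorm).smul (hasFDerivAt_id z)).congr_fderiv ?_
  ext w
  simp only [Submodule.starProjection_orthogonal', Submodule.starProjection_singleton,
    add_apply, smul_apply, sub_apply, one_apply_eq_self, ContinuousLinearMap.smulRight_apply,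
    ContinuousLinearMap.id_apply, innerSL_apply_apply, smul_eq_mul, id_eq, Function.comp_apply,
    RCLike.ofReal_real_eq_id]
  match_scalars <;> field_simp

variable {E : Type*} [NormedAddCommGroup E] [InnerProductSpace ℝ E]

/-- The map `E × ℂ → closedBall 0 R` that sends `z` to the `E`-component of `(R / ‖z‖) z`, with the
junk value `0` at `z = 0`. The factor `ℂ` is what makes the image of a Gaussian vector uniformly
distributed (Archimedes' theorem): slicing by `‖z‖ ^ 2 = ‖p‖ ^ 2 + ‖q‖ ^ 2`, the area element of
`ℂ` is `π d(‖q‖ ^ 2)`, so that no density in `p` remains. -/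
noncomputable def ballProj (R : ℝ) (z : WithLp 2 (E × ℂ)) : E := R • (‖z‖⁻¹ • z).fst

theorem contDiffOn_ballProj (R : ℝ) :
    ContDiffOn ℝ ∞ (ballProj R : WithLp 2 (E × ℂ) → E) {0}ᶜ := by
  have h : ContDiffOn ℝ ∞ (fun z : WithLp 2 (E × ℂ) => ‖z‖⁻¹ • z) {0}ᶜ :=
    ((contDiffOn_id.norm ℝ fun _ hz => by simpa using hz).inv fun _ hz =>
      norm_ne_zero_iff.2 (by simpa using hz)).smul contDiffOn_id
  exact ((WithLp.fstL 2 ℝ E ℂ).contDiff.comp_contDiffOn h).const_smul R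

theorem enorm_fderiv_comp_ballProj_le {f : E → ℝ} (hf : Differentiable ℝ f) {R : ℝ} (hR : 0 ≤ R)
    {z : WithLp 2 (E × ℂ)} (hz : z ≠ 0) :
    ‖fderiv ℝ (f ∘ ballProj R) z‖ₑ ≤
      ENNReal.ofReal (R * ‖z‖⁻¹) * ‖fderiv ℝ f (ballProj R z)‖ₑ := by
  have hP : HasFDerivAt (ballProj R) _ z :=
    ((WithLp.fstL 2 ℝ E ℂ).hasFDerivAt.comp z (hasFDerivAt_inv_norm_smul hz)).const_smul R
  rw [((hf _).hasFDerivAt.comp z hP).fderiv, ← ofReal_norm, ← ofReal_norm,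
    ← ofReal_mul (by positivity), mul_comm _ ‖fderiv ℝ f _‖]
  refine ofReal_le_ofReal ((ContinuousLinearMap.opNorm_comp_le _ _).trans ?_)
  gcongr
  refine ContinuousLinearMap.opNorm_le_bound _ (by positivity) fun w => ?_
  calc ‖R • ((‖z‖⁻¹ • (ℝ ∙ z)ᗮ.starProjection) w).fst‖
      ≤ R * ‖(‖z‖⁻¹ • (ℝ ∙ z)ᗮ.starProjection) w‖ := by
        rw [norm_smul, Real.norm_of_nonneg hR]
        gcongr
        exact WithLp.norm_fst_le _ _
    _ ≤ R * ‖z‖⁻¹ * ‖w‖ := by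
        rw [smul_apply, norm_smul, norm_inv, norm_norm, ← mul_assoc]
        gcongr
        exact Submodule.norm_starProjection_apply_le _ w

theorem lintegral_comp_norm_sq_complex {h : ℝ → ℝ≥0∞} (hh : Measurable h) :
    ∫⁻ q : ℂ, h (‖q‖ ^ 2) = ENNReal.ofReal π * ∫⁻ s in Ioi (0 : ℝ), h s := by
  have himg : (fun r : ℝ => r ^ 2) '' Ioi 0 = Ioi 0 := by
    refine Subset.antisymm (image_subset_iff.2 fun r hr => pow_pos (mem_Ioi.1 hr) 2) fun s hs => ?_
    exact ⟨√s, Real.sqrt_pos.2 hs, Real.sq_sqrt (mem_Ioi.1 hs).le⟩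
  have hsub : ∫⁻ s in Ioi (0 : ℝ), h s =
      ∫⁻ r in Ioi (0 : ℝ), ENNReal.ofReal |2 * r| * h (r ^ 2) := by
    conv_lhs => rw [← himg]
    refine lintegral_image_eq_lintegral_abs_deriv_mul measurableSet_Ioi
      (f := fun r : ℝ => r ^ 2) (f' := fun r => 2 * r) (fun x _ => ?_) ?_ h
    · simpa using (hasDerivAt_pow 2 x).hasDerivWithinAt
    · exact fun a ha b hb hab =>
        (pow_left_inj₀ (mem_Ioi.1 ha).le (mem_Ioi.1 hb).le two_ne_zero).1 hab
  have hpolar : ∀ p ∈ polarCoord.target,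
      ENNReal.ofReal p.1 • h (‖Complex.polarCoord.symm p‖ ^ 2) =
        ENNReal.ofReal p.1 * h (p.1 ^ 2) := fun p _ => by
    rw [Complex.norm_polarCoord_symm, sq_abs, smul_eq_mul]
  calc ∫⁻ q : ℂ, h (‖q‖ ^ 2)
      = ∫⁻ r in Ioi (0 : ℝ), ENNReal.ofReal r * h (r ^ 2) * ENNReal.ofReal (2 * π) := by
        rw [← Complex.lintegral_comp_polarCoord_symm,
          setLIntegral_congr_fun polarCoord.open_target.measurableSet hpolar, polarCoord_target,
          Measure.volume_eq_prod, ← Measure.prod_restrict, lintegral_prod _ (by fun_prop)]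
        simp only [setLIntegral_const, Real.volume_Ioo, show π - -π = 2 * π by ring]
    _ = ENNReal.ofReal π * ∫⁻ s in Ioi (0 : ℝ), h s := by
        rw [hsub, ← lintegral_const_mul _ (by fun_prop)]
        refine setLIntegral_congr_fun measurableSet_Ioi fun r (hr : 0 < r) => ?_
        rw [abs_of_pos (by positivity), ← mul_assoc, ← ENNReal.ofReal_mul (by positivity),
          mul_right_comm, ← ENNReal.ofReal_mul hr.le]
        ring_nf

theorem three_le_finrank_prod_complex [FiniteDimensional ℝ E] [Nontrivial E] :
    3 ≤ finrank ℝ (WithLp 2 (E × ℂ)) := by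
  have := finrank_pos (R := ℝ) (M := E)
  rw [(WithLp.linearEquiv 2 ℝ (E × ℂ)).finrank_eq, finrank_prod, Complex.finrank_real_complex]
  omega

variable [FiniteDimensional ℝ E] [MeasurableSpace E] [BorelSpace E]

theorem lintegral_prod_complex_norm_sq {k : E × ℝ → ℝ≥0∞} (hk : Measurable k) :
    ∫⁻ z : WithLp 2 (E × ℂ), k (z.fst, ‖z‖ ^ 2) =
      ENNReal.ofReal π * ∫⁻ s in Ioi (0 : ℝ), ∫⁻ p in ball 0 √s, k (p, s) := by
  set D : Set (E × ℝ) := {y | ‖y.1‖ ^ 2 < y.2} with hD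
  have hkD : Measurable (D.indicator k) :=
    hk.indicator (measurableSet_lt (by fun_prop) (by fun_prop))
  have hfst (p : E) : ∫⁻ q : ℂ, k (p, ‖p‖ ^ 2 + ‖q‖ ^ 2) =
      ENNReal.ofReal π * ∫⁻ s in Ioi (0 : ℝ), D.indicator k (p, s) := by
    rw [lintegral_comp_norm_sq_complex (h := fun s => k (p, ‖p‖ ^ 2 + s)) (by fun_prop)]
    congr 1
    rw [← lintegral_indicator measurableSet_Ioi, ← lintegral_indicator measurableSet_Ioi,
      ← lintegral_add_left_eq_self ((Ioi 0).indicator fun s => D.indicator k (p, s)) (‖p‖ ^ 2)]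
    refine lintegral_congr fun s => ?_
    have hpos : 0 < s → 0 < ‖p‖ ^ 2 + s := add_pos_of_nonneg_of_pos (sq_nonneg _)
    simp only [indicator, mem_Ioi, hD, mem_ofPred_eq, lt_add_iff_pos_right]
    split_ifs <;> tauto
  calc ∫⁻ z : WithLp 2 (E × ℂ), k (z.fst, ‖z‖ ^ 2)
      = ∫⁻ p : E, ∫⁻ q : ℂ, k (p, ‖p‖ ^ 2 + ‖q‖ ^ 2) := by
        rw [← (WithLp.volume_preserving_toLp E ℂ).lintegral_comp (by fun_prop),
          Measure.volume_eq_prod, lintegral_prod _ (by fun_prop)]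
        simp_rw [WithLp.prod_norm_sq_eq_of_L2]
        rfl
    _ = ENNReal.ofReal π * ∫⁻ s in Ioi (0 : ℝ), ∫⁻ p : E, D.indicator k (p, s) := by
        simp_rw [hfst]
        rw [lintegral_const_mul _ (by fun_prop), lintegral_lintegral_swap (by fun_prop)]
    _ = _ := by
        refine congrArg _ (lintegral_congr fun s => ?_)
        rw [← lintegral_indicator measurableSet_ball]
        refine lintegral_congr fun p => ?_
        simp only [indicator, hD, mem_ofPred_eq, mem_ball_zero_iff, Real.lt_sqrt (norm_nonneg p)]

theorem lintegral_ball_comp_smul {r R : ℝ} (hr : 0 < r) (hR : 0 < R) {F : E → ℝ≥0∞}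
    (hF : Measurable F) :
    ∫⁻ p in ball 0 r, F ((R / r) • p) =
      ENNReal.ofReal ((r / R) ^ finrank ℝ E) * ∫⁻ x in ball 0 R, F x := by
  have hpre : ((R / r) • · : E → E) ⁻¹' ball 0 R = ball 0 r := by
    ext p
    simp only [mem_preimage, mem_ball_zero_iff, norm_smul, Real.norm_of_nonneg (div_pos hR hr).le]
    rw [div_mul_eq_mul_div, div_lt_iff₀ hr, mul_lt_mul_iff_right₀ hR]
  have hc : R / r ≠ 0 := by positivity
  have hmap := congrArg (∫⁻ x in ball 0 R, F x ∂·) (Measure.map_addHaar_smul volume hc)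
  rw [Measure.restrict_smul, lintegral_smul_measure, smul_eq_mul,
    setLIntegral_map measurableSet_ball hF (by fun_prop), hpre] at hmap
  rw [hmap, abs_of_pos (by positivity), ← inv_pow, inv_div]

@[fun_prop]
theorem measurable_ballProj (R : ℝ) :
    Measurable (ballProj R : WithLp 2 (E × ℂ) → E) := by
  unfold ballProj
  fun_prop

theorem lintegral_comp_ballProj {R : ℝ} (hR : 0 < R) {F : E → ℝ≥0∞} (hF : Measurable F)
    {m : ℝ → ℝ≥0∞} (hm : Measurable m) :
    ∫⁻ z : WithLp 2 (E × ℂ), F (ballProj R z) * m (‖z‖ ^ 2) =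
      (ENNReal.ofReal π * ∫⁻ s in Ioi 0, m s * ENNReal.ofReal ((√s / R) ^ finrank ℝ E)) *
        ∫⁻ x in ball 0 R, F x := by
  have hk : Measurable fun y : E × ℝ => F ((R / √y.2) • y.1) * m y.2 := by fun_prop
  have hslice : ∀ s ∈ Ioi (0 : ℝ), ∫⁻ p in ball (0 : E) √s, F ((R / √s) • p) * m s =
      m s * ENNReal.ofReal ((√s / R) ^ finrank ℝ E) * ∫⁻ x in ball 0 R, F x := by
    intro s hs
    rw [lintegral_mul_const _ (by fun_prop),
      lintegral_ball_comp_smul (Real.sqrt_pos.2 hs) hR hF, mul_comm, mul_assoc]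
  have h := lintegral_prod_complex_norm_sq hk
  dsimp only at h
  rw [setLIntegral_congr_fun measurableSet_Ioi hslice, lintegral_mul_const _ (by fun_prop),
    ← mul_assoc] at h
  rw [← h]
  simp only [ballProj, WithLp.smul_fst, smul_smul, Real.sqrt_sq (norm_nonneg _), div_eq_mul_inv]

theorem lintegral_comp_ballProj_stdGaussian {R : ℝ} (hR : 0 < R) {F : E → ℝ≥0∞}
    (hF : Measurable F) {g : ℝ → ℝ≥0∞} (hg : Measurable g) :
    ∫⁻ z : WithLp 2 (E × ℂ), F (ballProj R z) * g ‖z‖ ∂stdGaussian (WithLp 2 (E × ℂ)) =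
      (∫⁻ z, g ‖z‖ ∂stdGaussian (WithLp 2 (E × ℂ))) * ⨍⁻ x in ball 0 R, F x ∂volume := by
  set ρ : ℝ → ℝ≥0∞ := fun r => ENNReal.ofReal
    ((2 * π) ^ (-(finrank ℝ (WithLp 2 (E × ℂ)) / 2 : ℝ)) * exp (-r ^ 2 / 2)) with hρ
  have hproj : ∀ F : E → ℝ≥0∞, Measurable F →
      ∫⁻ z : WithLp 2 (E × ℂ), F (ballProj R z) * g ‖z‖ ∂stdGaussian (WithLp 2 (E × ℂ)) =
        (ENNReal.ofReal π * ∫⁻ s in Ioi 0,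
          ρ √s * g √s * ENNReal.ofReal ((√s / R) ^ finrank ℝ E)) *
          ∫⁻ x in ball 0 R, F x := fun F hF => by
    rw [stdGaussian_eq_withDensity, lintegral_withDensity_eq_lintegral_mul _ (by fun_prop)
      (by fun_prop), ← lintegral_comp_ballProj hR hF (m := fun s => ρ √s * g √s) (by fun_prop)]
    refine lintegral_congr fun z => ?_
    simp only [Pi.mul_apply, hρ, Real.sqrt_sq (norm_nonneg z)]
    ring
  have hball : volume (ball (0 : E) R) ≠ 0 := (Metric.measure_ball_pos _ _ hR).ne'
  have hmass := hproj (fun _ => 1) measurable_const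
  simp only [one_mul, setLIntegral_one] at hmass
  rw [hproj F hF, setLAverage_eq, hmass, mul_assoc _ (volume _),
    ENNReal.mul_div_cancel hball measure_ball_lt_top.ne]

theorem lintegral_comp_ballProj_stdGaussian_eq_laverage {R : ℝ} (hR : 0 < R) {F : E → ℝ≥0∞}
    (hF : Measurable F) :
    ∫⁻ z : WithLp 2 (E × ℂ), F (ballProj R z) ∂stdGaussian (WithLp 2 (E × ℂ)) =
      ⨍⁻ x in ball 0 R, F x ∂volume := by
  simpa using lintegral_comp_ballProj_stdGaussian hR hF (g := fun _ => 1) measurable_const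

theorem lintegral_enorm_fderiv_comp_ballProj_le [Nontrivial E] {f : E → ℝ} (hf : ContDiff ℝ 1 f)
    {R : ℝ} (hR : 0 < R) :
    ∫⁻ z : WithLp 2 (E × ℂ), ‖fderiv ℝ (f ∘ ballProj R) z‖ₑ ∂stdGaussian (WithLp 2 (E × ℂ)) ≤
      ENNReal.ofReal R * ⨍⁻ x in ball 0 R, ‖fderiv ℝ f x‖ₑ ∂volume := by
  set γ := stdGaussian (WithLp 2 (E × ℂ))
  have hf'm := (hf.continuous_fderiv one_ne_zero).measurable.enorm
  have hrad : ∀ᵐ z ∂γ, ‖fderiv ℝ (f ∘ ballProj R) z‖ₑ ≤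
      ENNReal.ofReal (R * ‖z‖⁻¹) * ‖fderiv ℝ f (ballProj R z)‖ₑ := by
    filter_upwards [stdGaussian_absolutelyContinuous.ae_le (Measure.ae_ne volume 0)] with z hz
      using enorm_fderiv_comp_ballProj_le (hf.differentiable one_ne_zero) hR.le hz
  calc ∫⁻ z, ‖fderiv ℝ (f ∘ ballProj R) z‖ₑ ∂γ
      ≤ ∫⁻ z, ENNReal.ofReal R *
          (‖fderiv ℝ f (ballProj R z)‖ₑ * ENNReal.ofReal ‖z‖⁻¹) ∂γ := by
        refine lintegral_mono_ae (hrad.mono fun z hz => hz.trans_eq ?_)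
        rw [ofReal_mul hR.le, mul_assoc, mul_comm (ENNReal.ofReal ‖z‖⁻¹)]
    _ = ENNReal.ofReal R * ((∫⁻ z, ENNReal.ofReal ‖z‖⁻¹ ∂γ) *
          ⨍⁻ x in ball 0 R, ‖fderiv ℝ f x‖ₑ ∂volume) := by
        rw [lintegral_const_mul _ (by fun_prop), lintegral_comp_ballProj_stdGaussian hR hf'm
          (g := fun r => ENNReal.ofReal r⁻¹) (by fun_prop)]
    _ ≤ ENNReal.ofReal R * ⨍⁻ x in ball 0 R, ‖fderiv ℝ f x‖ₑ ∂volume := by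
        gcongr
        exact mul_le_of_le_one_left'
          (lintegral_inv_norm_stdGaussian_le_one three_le_finrank_prod_complex)

theorem laverage_ball_enorm_sub_le [Nontrivial E] {f : E → ℝ} (hf : ContDiff ℝ 1 f) {R : ℝ}
    (hR : 0 < R) :
    ⨍⁻ x in ball 0 R, (⨍⁻ y in ball 0 R, ‖f y - f x‖ₑ ∂volume) ∂volume ≤
      ENNReal.ofReal (2 * R) * ⨍⁻ x in ball 0 R, ‖fderiv ℝ f x‖ₑ ∂volume := by
  set γ := stdGaussian (WithLp 2 (E × ℂ))
  have hfm := hf.continuous.measurable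
  have hinner : Measurable fun x => ⨍⁻ y in ball 0 R, ‖f y - f x‖ₑ ∂volume := by
    simp only [setLAverage_eq]
    fun_prop
  have hdim : 1 < finrank ℝ (WithLp 2 (E × ℂ)) :=
    one_lt_two.trans (three_le_finrank_prod_complex (E := E))
  calc ⨍⁻ x in ball 0 R, (⨍⁻ y in ball 0 R, ‖f y - f x‖ₑ ∂volume) ∂volume
      = ∫⁻ z, ∫⁻ w, ‖f (ballProj R w) - f (ballProj R z)‖ₑ ∂γ ∂γ := by
        rw [← lintegral_comp_ballProj_stdGaussian_eq_laverage hR hinner]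
        refine lintegral_congr fun z => ?_
        rw [← lintegral_comp_ballProj_stdGaussian_eq_laverage hR (by fun_prop)]
    _ = ∫⁻ p, ‖(f ∘ ballProj R) p.2 - (f ∘ ballProj R) p.1‖ₑ ∂γ.prod γ := by
        rw [lintegral_prod _ (by fun_prop)]
        rfl
    _ ≤ ENNReal.ofReal (π / 2) * ∫⁻ z, ‖fderiv ℝ (f ∘ ballProj R) z‖ₑ ∂γ :=
        lintegral_prod_stdGaussian_enorm_sub_le hdim
          (hf.comp_contDiffOn ((contDiffOn_ballProj R).of_le (by simp)))
    _ ≤ ENNReal.ofReal 2 * (ENNReal.ofReal R * ⨍⁻ x in ball 0 R, ‖fderiv ℝ f x‖ₑ ∂volume) := by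
        gcongr
        · linarith [pi_le_four]
        · exact lintegral_enorm_fderiv_comp_ballProj_le hf hR
    _ = ENNReal.ofReal (2 * R) * ⨍⁻ x in ball 0 R, ‖fderiv ℝ f x‖ₑ ∂volume := by
        rw [← mul_assoc, ← ofReal_mul zero_le_two]

theorem lintegral_ball_prod_enorm_sub_le [Nontrivial E] {f : E → ℝ} (hf : ContDiff ℝ 1 f) {R : ℝ}
    (hR : 0 < R) :
    ∫⁻ p in ball 0 R ×ˢ ball 0 R, ‖f p.2 - f p.1‖ₑ ∂volume.prod volume ≤
      ENNReal.ofReal (2 * R) * volume (ball (0 : E) R)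
        * ∫⁻ x in ball 0 R, ‖fderiv ℝ f x‖ₑ := by
  have := hf.continuous.measurable
  set v := volume (ball (0 : E) R) with hv
  have hv0 : v ≠ 0 := (Metric.measure_ball_pos _ _ hR).ne'
  have hvtop : v ≠ ⊤ := measure_ball_lt_top.ne
  have havg := laverage_ball_enorm_sub_le hf hR
  simp_rw [setLAverage_eq, ← hv, ENNReal.div_eq_inv_mul] at havg
  rw [lintegral_const_mul' _ _ (inv_ne_top.2 hv0)] at havg
  rw [← Measure.prod_restrict, lintegral_prod _ (by fun_prop)]
  calc ∫⁻ x in ball 0 R, ∫⁻ y in ball 0 R, ‖f y - f x‖ₑ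
      = v * v * (v⁻¹ * (v⁻¹ * ∫⁻ x in ball 0 R, ∫⁻ y in ball 0 R, ‖f y - f x‖ₑ)) := by
        rw [← mul_assoc v⁻¹, ← mul_assoc (v * v), ← ENNReal.mul_inv (.inl hv0) (.inl hvtop),
          ENNReal.mul_inv_cancel (mul_ne_zero hv0 hv0) (mul_ne_top hvtop hvtop), one_mul]
    _ ≤ v * v * (ENNReal.ofReal (2 * R) * (v⁻¹ * ∫⁻ x in ball 0 R, ‖fderiv ℝ f x‖ₑ)) := by
        gcongr
    _ = _ := by
        rw [mul_left_comm (ENNReal.ofReal _), mul_assoc v, ENNReal.mul_inv_cancel_left hv0 hvtop]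
        ring

end Radial

section Mollification

open Filter Topology ENNReal ContinuousLinearMap Convolution Metric

variable {V F : Type*} [NormedAddCommGroup V] [MeasurableSpace V] [BorelSpace V]
  [NormedAddCommGroup F] {μ : Measure V}

theorem tendsto_lintegral_enorm_translate_sub [μ.IsAddRightInvariant] [μ.InnerRegularCompactLTTop]
    [IsLocallyFiniteMeasure μ] {g : V → F} (hg : Integrable g μ) :
    Tendsto (fun t => ∫⁻ x, ‖g (x - t) - g x‖ₑ ∂μ) (𝓝 0) (𝓝 0) := by
  let translate : C(V, C(V, V)) := ContinuousMap.curry ⟨fun p : V × V => p.2 - p.1, by fun_prop⟩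
  have hpres : ∀ t, MeasurePreserving (translate t) μ μ := measurePreserving_sub_right μ
  have hcont : Continuous fun t => Lp.compMeasurePreserving (translate t) (hpres t) (hg.toL1 g) :=
    continuous_const.compMeasurePreservingLp translate.continuous hpres one_ne_top
  have hLp : ∀ t, ⇑(Lp.compMeasurePreserving (translate t) (hpres t) (hg.toL1 g))
      =ᵐ[μ] fun x => g (x - t) := fun t =>
    (Lp.coeFn_compMeasurePreserving _ (hpres t)).trans
      ((hpres t).quasiMeasurePreserving.ae_eq_comp hg.coeFn_toL1)
  refine (tendsto_iff_edist_tendsto_0.1 (hcont.tendsto 0)).congr fun t => ?_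
  rw [L1.edist_def]
  refine lintegral_congr_ae ?_
  filter_upwards [hLp t, hLp 0] with x ht h0
  rw [ht, h0, edist_eq_enorm_sub, sub_zero]

variable [InnerProductSpace ℝ V] [FiniteDimensional ℝ V] [NormedSpace ℝ F] [CompleteSpace F]
  [μ.IsAddHaarMeasure]

theorem enorm_normed_convolution_sub_le (φ : ContDiffBump (0 : V)) {g : V → F}
    (hg : LocallyIntegrable g μ) (x : V) :
    ‖(φ.normed μ ⋆[lsmul ℝ ℝ, μ] g) x - g x‖ₑ
      ≤ ∫⁻ t, ‖φ.normed μ t‖ₑ * ‖g (x - t) - g x‖ₑ ∂μ := by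
  have hconv : Integrable (fun t => φ.normed μ t • g (x - t)) μ :=
    φ.hasCompactSupport_normed.convolutionExists_left (lsmul ℝ ℝ) φ.continuous_normed hg x
  calc ‖(φ.normed μ ⋆[lsmul ℝ ℝ, μ] g) x - g x‖ₑ
      = ‖∫ t, φ.normed μ t • (g (x - t) - g x) ∂μ‖ₑ := by
        simp_rw [smul_sub]
        rw [integral_sub hconv (φ.integrable_normed.smul_const _), φ.integral_normed_smul,
          convolution_lsmul]
    _ ≤ _ := by
        simp_rw [← enorm_smul]
        exact enorm_integral_le_lintegral_enorm _

theorem lintegral_enorm_normed_convolution_sub_le (φ : ContDiffBump (0 : V)) {g : V → F}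
    (hg : Integrable g μ) {ε : ℝ≥0∞}
    (hε : ∀ t ∈ ball 0 φ.rOut, ∫⁻ x, ‖g (x - t) - g x‖ₑ ∂μ ≤ ε) :
    ∫⁻ x, ‖(φ.normed μ ⋆[lsmul ℝ ℝ, μ] g) x - g x‖ₑ ∂μ ≤ ε := by
  have hφ1 : ∫⁻ t, ‖φ.normed μ t‖ₑ ∂μ = 1 := by
    have := ofReal_integral_eq_lintegral_ofReal (φ.integrable_normed (μ := μ))
      (.of_forall φ.nonneg_normed)
    simpa [φ.integral_normed, Real.enorm_of_nonneg (φ.nonneg_normed _)] using this.symm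
  have hmeas : AEMeasurable (fun p : V × V => ‖φ.normed μ p.2‖ₑ * ‖g (p.1 - p.2) - g p.1‖ₑ)
      (μ.prod μ) :=
    (φ.continuous_normed.measurable.comp measurable_snd).enorm.aemeasurable.mul
      ((hg.1.comp_quasiMeasurePreserving (quasiMeasurePreserving_sub_of_right_invariant μ μ)).sub
        hg.1.comp_fst).enorm
  calc ∫⁻ x, ‖(φ.normed μ ⋆[lsmul ℝ ℝ, μ] g) x - g x‖ₑ ∂μ
      ≤ ∫⁻ x, ∫⁻ t, ‖φ.normed μ t‖ₑ * ‖g (x - t) - g x‖ₑ ∂μ ∂μ :=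
        lintegral_mono fun x => enorm_normed_convolution_sub_le φ hg.locallyIntegrable x
    _ = ∫⁻ t, ‖φ.normed μ t‖ₑ * ∫⁻ x, ‖g (x - t) - g x‖ₑ ∂μ ∂μ := by
        rw [lintegral_lintegral_swap hmeas]
        simp_rw [lintegral_const_mul' _ _ enorm_ne_top]
    _ ≤ ∫⁻ t, ‖φ.normed μ t‖ₑ * ε ∂μ := by
        refine lintegral_mono fun t => ?_
        by_cases ht : t ∈ ball 0 φ.rOut
        · gcongr
          exact hε t ht
        · rw [← φ.support_normed_eq (μ := μ), Function.notMem_support] at ht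
          simp [ht]
    _ = ε := by
        rw [lintegral_mul_const _ φ.continuous_normed.measurable.enorm, hφ1, one_mul]

theorem tendsto_lintegral_enorm_normed_convolution_sub {ι : Type*} {l : Filter ι}
    {φ : ι → ContDiffBump (0 : V)} (hφ : Tendsto (fun n => (φ n).rOut) l (𝓝 0)) {g : V → F}
    (hg : Integrable g μ) :
    Tendsto (fun n => ∫⁻ x, ‖((φ n).normed μ ⋆[lsmul ℝ ℝ, μ] g) x - g x‖ₑ ∂μ) l (𝓝 0) := by
  refine ENNReal.tendsto_nhds_zero.2 fun ε hε => ?_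
  obtain ⟨δ, hδ, hball⟩ := Metric.eventually_nhds_iff_ball.1 <|
    ENNReal.tendsto_nhds_zero.1 (tendsto_lintegral_enorm_translate_sub hg) ε hε
  filter_upwards [hφ.eventually_lt_const hδ] with n hn
  exact lintegral_enorm_normed_convolution_sub_le _ hg fun t ht =>
    hball t (ball_subset_ball hn.le ht)

theorem tendsto_setLIntegral_enorm_normed_convolution_indicator_sub {ι : Type*} {l : Filter ι}
    {φ : ι → ContDiffBump (0 : V)} (hφ : Tendsto (fun n => (φ n).rOut) l (𝓝 0)) {g : V → F}
    {s t : Set V} (hs : MeasurableSet s) (ht : MeasurableSet t) (hst : s ⊆ t)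
    (hg : IntegrableOn g t μ) :
    Tendsto (fun n => ∫⁻ x in s, ‖((φ n).normed μ ⋆[lsmul ℝ ℝ, μ] t.indicator g) x - g x‖ₑ ∂μ) l
      (𝓝 0) := by
  refine tendsto_of_tendsto_of_tendsto_of_le_of_le tendsto_const_nhds
    (tendsto_lintegral_enorm_normed_convolution_sub hφ ((integrable_indicator_iff ht).2 hg))
    (fun _ => zero_le) fun n => ?_
  refine (setLIntegral_mono' hs fun x hx => ?_).trans (setLIntegral_le_lintegral s _)
  rw [Set.indicator_of_mem (hst hx)]

end Mollification

section WeakGradient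

open Filter Topology ENNReal ContinuousLinearMap Convolution Metric Gradient

theorem setIntegral_mul_eq_integral_of_tsupport_subset {X : Type*} [TopologicalSpace X]
    [MeasurableSpace X] {μ : Measure X} {g φ : X → ℝ} {s : Set X} (hφ : tsupport φ ⊆ s) :
    ∫ x in s, g x * φ x ∂μ = ∫ x, g x * φ x ∂μ :=
  setIntegral_eq_integral_of_forall_compl_eq_zero fun x hx => by
    rw [image_eq_zero_of_notMem_tsupport fun h => hx (hφ h), mul_zero]

theorem tendsto_setIntegral_mul_of_L1 {X : Type*} [TopologicalSpace X] [MeasurableSpace X]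
    [OpensMeasurableSpace X] {μ : Measure X} {K : Set X} {f : ℕ → X → ℝ} {g φ : X → ℝ}
    (hφ : Continuous φ) (hφc : HasCompactSupport φ)
    (hf : ∀ n, IntegrableOn (f n) K μ) (hg : IntegrableOn g K μ)
    (hfg : Tendsto (fun n => ∫⁻ x in K, ‖f n x - g x‖ₑ ∂μ) atTop (𝓝 0)) :
    Tendsto (fun n => ∫ x in K, f n x * φ x ∂μ) atTop (𝓝 (∫ x in K, g x * φ x ∂μ)) := by
  obtain ⟨C, hC⟩ := hφc.exists_bound_of_continuous hφ
  have hint : ∀ {h : X → ℝ}, IntegrableOn h K μ → IntegrableOn (fun x => h x * φ x) K μ :=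
    fun hh => hh.mul_bdd (c := C) hφ.aestronglyMeasurable (.of_forall hC)
  refine tendsto_integral_of_L1 _ (hint hg).aestronglyMeasurable (.of_forall fun n => hint (hf n))
    ?_
  have hlim := ENNReal.Tendsto.const_mul hfg (.inr (ofReal_ne_top (r := C)))
  rw [mul_zero] at hlim
  refine tendsto_of_tendsto_of_tendsto_of_le_of_le tendsto_const_nhds hlim (fun _ => zero_le)
    fun n => ?_
  rw [← lintegral_const_mul' _ _ ofReal_ne_top]
  refine lintegral_mono fun x => ?_
  rw [← sub_mul, enorm_mul, mul_comm]
  gcongr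
  rw [← ofReal_norm]
  exact ofReal_le_ofReal (hC x)

theorem fderiv_convolution_lsmul_apply {V : Type*} [NormedAddCommGroup V] [NormedSpace ℝ V]
    [FiniteDimensional ℝ V] [MeasurableSpace V] [BorelSpace V] {μ : Measure V}
    [μ.IsAddHaarMeasure] {ρ g : V → ℝ} (hρc : HasCompactSupport ρ) (hρ : ContDiff ℝ 1 ρ)
    (hg : LocallyIntegrable g μ) (x v : V) :
    fderiv ℝ (ρ ⋆[lsmul ℝ ℝ, μ] g) x v = ∫ y, g y * fderiv ℝ ρ (x - y) v ∂μ := by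
  have hconv : ConvolutionExistsAt (fderiv ℝ ρ) g x ((lsmul ℝ ℝ).precompL V) μ :=
    (hρc.fderiv ℝ).convolutionExists_left _ (hρ.continuous_fderiv one_ne_zero) hg x
  rw [(hρc.hasFDerivAt_convolution_left (lsmul ℝ ℝ) hρ hg x).fderiv, convolution_def,
    ContinuousLinearMap.integral_apply hconv, ← integral_sub_left_eq_self _ μ x]
  simp [precompL_apply, mul_comm]

theorem fderiv_comp_const_sub {V W : Type*} [NormedAddCommGroup V] [NormedSpace ℝ V]
    [NormedAddCommGroup W] [NormedSpace ℝ W] {f : V → W} {c x : V}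
    (hf : DifferentiableAt ℝ f (c - x)) :
    fderiv ℝ (fun y => f (c - y)) x = -fderiv ℝ f (c - x) := by
  refine (hf.hasFDerivAt.comp x ((hasFDerivAt_id x).const_sub c)).fderiv.trans ?_
  rw [comp_neg, ContinuousLinearMap.comp_id]

theorem tsupport_normed_comp_const_sub_subset {V : Type*} [NormedAddCommGroup V]
    [InnerProductSpace ℝ V] [FiniteDimensional ℝ V] [MeasurableSpace V] [BorelSpace V]
    {μ : Measure V} [μ.IsAddHaarMeasure] (φ : ContDiffBump (0 : V)) (x : V) :
    tsupport (fun y => φ.normed μ (x - y)) ⊆ closedBall x φ.rOut := by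
  refine closure_minimal (fun y hy => ?_) isClosed_closedBall
  have := φ.support_normed_eq.subset (show x - y ∈ Function.support (φ.normed μ) from hy)
  rw [mem_ball_zero_iff, ← dist_eq_norm, dist_comm] at this
  exact this.le

variable {d : ℕ} {u : EuclideanSpace ℝ (Fin d) → ℝ}
  {G : EuclideanSpace ℝ (Fin d) → EuclideanSpace ℝ (Fin d)}
  {Ω K : Set (EuclideanSpace ℝ (Fin d))}

theorem gradient_apply_eq_fderiv (f : EuclideanSpace ℝ (Fin d) → ℝ) (x : EuclideanSpace ℝ (Fin d))
    (i : Fin d) : ∇ f x i = fderiv ℝ f x (EuclideanSpace.single i 1) := by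
  rw [← inner_gradient_left, EuclideanSpace.inner_single_right]
  simp

theorem HasWeakGradientOn.mono (h : HasWeakGradientOn u G Ω) (hK : K ⊆ Ω) :
    HasWeakGradientOn u G K := by
  refine ⟨h.1.mono_set hK, h.2.1.mono_set hK, fun φ hφ hφc hφK i => ?_⟩
  have hφ' := tsupport_fderiv_apply_subset ℝ (f := φ) (EuclideanSpace.single i 1)
  rw [setIntegral_mul_eq_integral_of_tsupport_subset (hφ'.trans hφK),
    setIntegral_mul_eq_integral_of_tsupport_subset hφK,
    ← setIntegral_mul_eq_integral_of_tsupport_subset (hφ'.trans (hφK.trans hK)),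
    ← setIntegral_mul_eq_integral_of_tsupport_subset (hφK.trans hK)]
  exact h.2.2 φ hφ hφc (hφK.trans hK) i

theorem hasWeakGradientOn_of_forall_isCompact (hΩ : IsOpen Ω)
    (h : ∀ K ⊆ Ω, IsCompact K → HasWeakGradientOn u G K) : HasWeakGradientOn u G Ω := by
  refine ⟨(locallyIntegrableOn_iff hΩ.isLocallyClosed).2 fun K hK hKc =>
    (h K hK hKc).1.integrableOn_isCompact hKc, (locallyIntegrableOn_iff hΩ.isLocallyClosed).2
      fun K hK hKc => (h K hK hKc).2.1.integrableOn_isCompact hKc, fun φ hφ hφc hφΩ i => ?_⟩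
  have hφ' := tsupport_fderiv_apply_subset ℝ (f := φ) (EuclideanSpace.single i 1)
  rw [setIntegral_mul_eq_integral_of_tsupport_subset (hφ'.trans hφΩ),
    setIntegral_mul_eq_integral_of_tsupport_subset hφΩ,
    ← setIntegral_mul_eq_integral_of_tsupport_subset hφ',
    ← setIntegral_mul_eq_integral_of_tsupport_subset (subset_refl (tsupport φ))]
  exact (h _ hφΩ hφc).2.2 φ hφ hφc subset_rfl i

theorem continuous_gradient {f : EuclideanSpace ℝ (Fin d) → ℝ} (hf : ContDiff ℝ 1 f) :
    Continuous (∇ f) :=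
  (LinearIsometryEquiv.continuous _).comp (hf.continuous_fderiv one_ne_zero)

theorem hasWeakGradientOn_gradient {f : EuclideanSpace ℝ (Fin d) → ℝ} (hf : ContDiff ℝ 1 f)
    (Ω : Set (EuclideanSpace ℝ (Fin d))) : HasWeakGradientOn f (∇ f) Ω := by
  refine ⟨hf.continuous.locallyIntegrable.locallyIntegrableOn Ω,
    (continuous_gradient hf).locallyIntegrable.locallyIntegrableOn Ω, fun φ hφ hφc hφΩ i => ?_⟩
  set e : EuclideanSpace ℝ (Fin d) := EuclideanSpace.single i 1
  have hφ' := tsupport_fderiv_apply_subset ℝ (f := φ) e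
  have hint : ∀ {g ψ : EuclideanSpace ℝ (Fin d) → ℝ}, Continuous g → Continuous ψ →
      tsupport ψ ⊆ tsupport φ → Integrable fun x => g x * ψ x := fun {_ ψ} hg hψ hψφ =>
    (hg.mul hψ).integrable_of_hasCompactSupport
      (.mul_left (hφc.of_isClosed_subset (isClosed_tsupport ψ) hψφ))
  have hcont : ∀ {g : EuclideanSpace ℝ (Fin d) → ℝ}, ContDiff ℝ 1 g →
      Continuous fun x => fderiv ℝ g x e := fun hg =>
    (hg.continuous_fderiv one_ne_zero).clm_apply continuous_const
  have hφ1 : ContDiff ℝ 1 φ := hφ.of_le (by simp)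
  simp_rw [gradient_apply_eq_fderiv]
  rw [setIntegral_mul_eq_integral_of_tsupport_subset (hφ'.trans hφΩ),
    setIntegral_mul_eq_integral_of_tsupport_subset hφΩ]
  exact integral_mul_fderiv_eq_neg_fderiv_mul_of_integrable
    (hint (hcont hf) hφ.continuous subset_rfl) (hint hf.continuous (hcont hφ1) hφ')
    (hint hf.continuous hφ.continuous subset_rfl)
    (fun x _ => hf.differentiable one_ne_zero x) fun x _ => hφ1.differentiable one_ne_zero x

theorem HasWeakGradientOn.of_tendsto_L1 (hK : IsCompact K)
    {f : ℕ → EuclideanSpace ℝ (Fin d) → ℝ}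
    {F : ℕ → EuclideanSpace ℝ (Fin d) → EuclideanSpace ℝ (Fin d)}
    (hf : ∀ n, HasWeakGradientOn (f n) (F n) K) (hu : IntegrableOn u K) (hG : IntegrableOn G K)
    (hfu : Tendsto (fun n => ∫⁻ x in K, ‖f n x - u x‖ₑ) atTop (𝓝 0))
    (hFG : Tendsto (fun n => ∫⁻ x in K, ‖F n x - G x‖ₑ) atTop (𝓝 0)) :
    HasWeakGradientOn u G K := by
  refine ⟨hu.locallyIntegrableOn, hG.locallyIntegrableOn, fun φ hφ hφc hφK i => ?_⟩
  have hφ' := tsupport_fderiv_apply_subset ℝ (f := φ) (EuclideanSpace.single i 1)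
  have hcoord : ∀ {H : EuclideanSpace ℝ (Fin d) → EuclideanSpace ℝ (Fin d)},
      IntegrableOn H K → IntegrableOn (fun x => H x i) K :=
    fun hH => (EuclideanSpace.proj (𝕜 := ℝ) i).integrable_comp hH
  have hFGi : Tendsto (fun n => ∫⁻ x in K, ‖F n x i - G x i‖ₑ) atTop (𝓝 0) :=
    tendsto_of_tendsto_of_tendsto_of_le_of_le tendsto_const_nhds hFG (fun _ => zero_le)
      fun n => lintegral_mono fun x => enorm_le_iff_norm_le.2 (PiLp.norm_apply_le (F n x - G x) i)
  have hleft := tendsto_setIntegral_mul_of_L1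
    ((hφ.continuous_fderiv (by simp)).clm_apply continuous_const)
    (hφc.of_isClosed_subset (isClosed_tsupport _) hφ')
    (fun n => (hf n).1.integrableOn_isCompact hK) hu hfu
  have hright := tendsto_setIntegral_mul_of_L1 hφ.continuous hφc
    (fun n => hcoord ((hf n).2.1.integrableOn_isCompact hK)) (hcoord hG) hFGi
  exact tendsto_nhds_unique (hleft.congr fun n => (hf n).2.2 φ hφ hφc hφK i) hright.neg

theorem HasWeakGradientOn.gradient_convolution (h : HasWeakGradientOn u G K) (hK : IsCompact K)
    (φ : ContDiffBump (0 : EuclideanSpace ℝ (Fin d))) {x : EuclideanSpace ℝ (Fin d)}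
    (hx : closedBall x φ.rOut ⊆ K) :
    ∇ (φ.normed volume ⋆[lsmul ℝ ℝ, volume] K.indicator u) x
      = (φ.normed volume ⋆[lsmul ℝ ℝ, volume] K.indicator G) x := by
  set ρ : EuclideanSpace ℝ (Fin d) → ℝ := φ.normed volume
  have hρs : ContDiff ℝ ∞ ρ := φ.contDiff_normed
  have hρc : HasCompactSupport ρ := φ.hasCompactSupport_normed
  have huK : Integrable (K.indicator u) :=
    (integrable_indicator_iff hK.measurableSet).2 (h.1.integrableOn_isCompact hK)
  have hGK : Integrable (K.indicator G) :=
    (integrable_indicator_iff hK.measurableSet).2 (h.2.1.integrableOn_isCompact hK)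
  set ψ : EuclideanSpace ℝ (Fin d) → ℝ := fun y => ρ (x - y) with hψ
  have hψs : ContDiff ℝ ∞ ψ := hρs.comp (contDiff_const.sub contDiff_id)
  have hψK : tsupport ψ ⊆ K := (tsupport_normed_comp_const_sub_subset φ x).trans hx
  have hind : ∀ f g : EuclideanSpace ℝ (Fin d) → ℝ,
      ∫ y, K.indicator f y * g y = ∫ y in K, f y * g y := fun f g => by
    rw [← integral_indicator hK.measurableSet]
    simp_rw [Set.indicator_mul_left]
  have hconv : Integrable fun y => ρ (x - y) • K.indicator G y :=
    convolutionExistsAt_iff_integrable_swap.1 <|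
      hρc.convolutionExists_left (lsmul ℝ ℝ) hρs.continuous hGK.locallyIntegrable x
  ext i
  calc ∇ (ρ ⋆[lsmul ℝ ℝ, volume] K.indicator u) x i
      = -∫ y in K, u y * fderiv ℝ ψ y (EuclideanSpace.single i 1) := by
        rw [gradient_apply_eq_fderiv, fderiv_convolution_lsmul_apply hρc (hρs.of_le (by simp))
          huK.locallyIntegrable, ← hind, ← integral_neg]
        simp_rw [hψ, fderiv_comp_const_sub (hρs.differentiable (by simp) _), neg_apply, mul_neg,
          neg_neg]
    _ = ∫ y, K.indicator (fun y => G y i) y * ψ y := by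
        rw [h.2.2 ψ hψs (hK.of_isClosed_subset (isClosed_tsupport _) hψK) hψK i, neg_neg, hind]
    _ = (ρ ⋆[lsmul ℝ ℝ, volume] K.indicator G) x i := by
        rw [convolution_lsmul_swap]
        refine .trans ?_ ((EuclideanSpace.proj (𝕜 := ℝ) i).integral_comp_comm hconv)
        refine integral_congr_ae (.of_forall fun y => ?_)
        by_cases hy : y ∈ K <;> simp [hy, hψ, mul_comm]

theorem HasWeakGradientOn.exists_contDiff_tendsto (h : HasWeakGradientOn u G Ω) (hΩ : IsOpen Ω)
    (hK : IsCompact K) (hKΩ : K ⊆ Ω) :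
    ∃ f : ℕ → EuclideanSpace ℝ (Fin d) → ℝ, (∀ n, ContDiff ℝ 1 (f n)) ∧
      (∀ᵐ x ∂volume.restrict K, Tendsto (fun n => f n x) atTop (𝓝 (u x))) ∧
      Tendsto (fun n => ∫⁻ x in K, ‖f n x - u x‖ₑ) atTop (𝓝 0) ∧
      Tendsto (fun n => ∫⁻ x in K, ‖∇ (f n) x - G x‖ₑ) atTop (𝓝 0) := by
  obtain ⟨δ, hδ, hδΩ⟩ := hK.exists_cthickening_subset_open hΩ hKΩ
  have hC : IsCompact (cthickening δ K) := hK.cthickening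
  have hKC : K ⊆ cthickening δ K := self_subset_cthickening K
  have huC : IntegrableOn u (cthickening δ K) := h.1.integrableOn_compact_subset hδΩ hC
  have hGC : IntegrableOn G (cthickening δ K) := h.2.1.integrableOn_compact_subset hδΩ hC
  have huC' : LocallyIntegrable ((cthickening δ K).indicator u) :=
    ((integrable_indicator_iff hC.measurableSet).2 huC).locallyIntegrable
  let φ : ℕ → ContDiffBump (0 : EuclideanSpace ℝ (Fin d)) := fun n =>
    { rIn := δ / (n + 1) / 2
      rOut := δ / (n + 1)
      rIn_pos := by positivity
      rIn_lt_rOut := half_lt_self (by positivity) }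
  have hφ : Tendsto (fun n => (φ n).rOut) atTop (𝓝 0) :=
    tendsto_const_nhds.div_atTop (tendsto_natCast_atTop_atTop.atTop_add tendsto_const_nhds)
  have hball : ∀ n, ∀ x ∈ K, closedBall x (φ n).rOut ⊆ cthickening δ K := fun n x hx =>
    (closedBall_subset_closedBall (div_le_self hδ.le (by simp))).trans
      (closedBall_subset_cthickening hx δ)
  refine ⟨fun n => (φ n).normed volume ⋆[lsmul ℝ ℝ, volume] (cthickening δ K).indicator u,
    fun n => (φ n).hasCompactSupport_normed.contDiff_convolution_left (n := 1) _
      (φ n).contDiff_normed huC', ?_, ?_, ?_⟩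
  · filter_upwards [ae_restrict_of_ae <|
      ContDiffBump.ae_convolution_tendsto_right_of_locallyIntegrable (μ := volume) (K := 2) hφ
        (.of_forall fun n => (mul_div_cancel₀ _ two_ne_zero).ge) huC',
      ae_restrict_mem hK.measurableSet] with x hx hxK
    rwa [Set.indicator_of_mem (hKC hxK)] at hx
  · exact tendsto_setLIntegral_enorm_normed_convolution_indicator_sub hφ hK.measurableSet
      hC.measurableSet hKC huC
  · refine (tendsto_setLIntegral_enorm_normed_convolution_indicator_sub hφ hK.measurableSet
      hC.measurableSet hKC hGC).congr fun n => setLIntegral_congr_fun hK.measurableSet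
      fun x hx => ?_
    simp only [(h.mono hδΩ).gradient_convolution hC (φ n) (hball n x hx)]

end WeakGradient

section Truncation

open Filter Topology ENNReal Metric Gradient

theorem tendsto_lintegral_enorm_smul_sub_smul {X F : Type*} [MeasurableSpace X]
    [NormedAddCommGroup F] [NormedSpace ℝ F] {μ : Measure X} {a : ℕ → X → ℝ} {b : X → ℝ}
    {f : ℕ → X → F} {g : X → F} {C : ℝ} (ha : ∀ n, AEStronglyMeasurable (a n) μ)
    (haC : ∀ n x, ‖a n x‖ ≤ C) (hab : ∀ᵐ x ∂μ, Tendsto (fun n => a n x) atTop (𝓝 (b x)))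
    (hg : Integrable g μ) (hfg : Tendsto (fun n => ∫⁻ x, ‖f n x - g x‖ₑ ∂μ) atTop (𝓝 0)) :
    Tendsto (fun n => ∫⁻ x, ‖a n x • f n x - b x • g x‖ₑ ∂μ) atTop (𝓝 0) := by
  have hmul := ENNReal.Tendsto.const_mul hfg (.inr (ofReal_ne_top (r := C)))
  have hdom : Tendsto (fun n => ∫⁻ x, ‖a n x • g x - b x • g x‖ₑ ∂μ) atTop (𝓝 0) := by
    simp_rw [← ofReal_norm]
    refine tendsto_lintegral_norm_of_dominated_convergence (fun n => (ha n).smul hg.1)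
      (hg.norm.const_mul C).2 (fun n => .of_forall fun x => ?_)
      (hab.mono fun x hx => hx.smul_const _)
    rw [norm_smul]
    exact mul_le_mul_of_nonneg_right (haC n x) (norm_nonneg _)
  have hsum := hmul.add hdom
  rw [mul_zero, add_zero] at hsum
  refine tendsto_of_tendsto_of_tendsto_of_le_of_le tendsto_const_nhds hsum (fun _ => zero_le)
    fun n => ?_
  have hmeas : AEMeasurable (fun x => ‖a n x • g x - b x • g x‖ₑ) μ :=
    (((ha n).smul hg.1).sub ((aestronglyMeasurable_of_tendsto_ae atTop ha hab).smul hg.1)).enorm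
  rw [← lintegral_const_mul' _ _ ofReal_ne_top, ← lintegral_add_right' _ hmeas]
  refine lintegral_mono fun x => ?_
  calc ‖a n x • f n x - b x • g x‖ₑ
      = ‖a n x • (f n x - g x) + (a n x • g x - b x • g x)‖ₑ := by congr 1; module
    _ ≤ ‖a n x‖ₑ * ‖f n x - g x‖ₑ + ‖a n x • g x - b x • g x‖ₑ := by
        rw [← enorm_smul]
        exact enorm_add_le _ _
    _ ≤ ENNReal.ofReal C * ‖f n x - g x‖ₑ + ‖a n x • g x - b x • g x‖ₑ := by
        rw [← ofReal_norm (a n x)]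
        gcongr
        exact haC n x

theorem enorm_intervalIntegral_sub_le {g : ℝ → ℝ} (hg : Continuous g) {C : ℝ}
    (hgC : ∀ s, ‖g s‖ ≤ C) (c s t : ℝ) :
    ‖(∫ r in c..s, g r) - ∫ r in c..t, g r‖ₑ ≤ ENNReal.ofReal C * ‖s - t‖ₑ := by
  rw [intervalIntegral.integral_interval_sub_left (hg.intervalIntegrable _ _)
    (hg.intervalIntegrable _ _), ← ofReal_norm, ← ofReal_norm,
    ← ofReal_mul ((norm_nonneg _).trans (hgC 0))]
  exact ofReal_le_ofReal (intervalIntegral.norm_integral_le_of_norm_le_const fun r _ => hgC r)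

theorem contDiff_one_intervalIntegral {g : ℝ → ℝ} (hg : Continuous g) (c : ℝ) :
    ContDiff ℝ 1 fun s => ∫ t in c..s, g t := by
  refine contDiff_one_iff_deriv.2
    ⟨fun s => (hg.integral_hasStrictDerivAt c s).hasDerivAt.differentiableAt, ?_⟩
  rwa [funext fun s => (hg.integral_hasStrictDerivAt c s).hasDerivAt.deriv]

variable {d : ℕ} {u : EuclideanSpace ℝ (Fin d) → ℝ}
  {G : EuclideanSpace ℝ (Fin d) → EuclideanSpace ℝ (Fin d)}
  {Ω : Set (EuclideanSpace ℝ (Fin d))}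

theorem gradient_intervalIntegral {g : ℝ → ℝ} (hg : Continuous g) (c : ℝ)
    {f : EuclideanSpace ℝ (Fin d) → ℝ} {x : EuclideanSpace ℝ (Fin d)}
    (hf : DifferentiableAt ℝ f x) : ∇ (fun y => ∫ t in c..f y, g t) x = g (f x) • ∇ f x := by
  have := (hg.integral_hasStrictDerivAt c (f x)).hasDerivAt.comp_hasFDerivAt x hf.hasFDerivAt
  rw [gradient, gradient, ← map_smul]
  exact congrArg _ this.fderiv

theorem HasWeakGradientOn.comp_intervalIntegral (h : HasWeakGradientOn u G Ω) (hΩ : IsOpen Ω)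
    {g : ℝ → ℝ} (hg : Continuous g) {C : ℝ} (hgC : ∀ s, ‖g s‖ ≤ C) (c : ℝ) :
    HasWeakGradientOn (fun x => ∫ t in c..u x, g t) (fun x => g (u x) • G x) Ω := by
  refine hasWeakGradientOn_of_forall_isCompact hΩ fun K hKΩ hK => ?_
  obtain ⟨f, hf, hfu, hfuK, hfG⟩ := h.exists_contDiff_tendsto hΩ hK hKΩ
  have : IsFiniteMeasure (volume.restrict K) := ⟨by simpa using hK.measure_lt_top⟩
  have hu : IntegrableOn u K := h.1.integrableOn_compact_subset hKΩ hK
  have hG : IntegrableOn G K := h.2.1.integrableOn_compact_subset hKΩ hK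
  have hΨ := contDiff_one_intervalIntegral hg c
  have hΨu : IntegrableOn (fun x => ∫ t in c..u x, g t) K := by
    refine ((hu.sub (integrable_const c)).norm.const_mul C).mono'
      (hΨ.continuous.comp_aestronglyMeasurable hu.1) (.of_forall fun x => ?_)
    exact intervalIntegral.norm_integral_le_of_norm_le_const fun t _ => hgC t
  refine .of_tendsto_L1 hK (fun n => hasWeakGradientOn_gradient (hΨ.comp (hf n)) K) hΨu
    (hG.bdd_smul C (hg.comp_aestronglyMeasurable hu.1) (.of_forall fun x => hgC _)) ?_ ?_
  · have hlim := ENNReal.Tendsto.const_mul hfuK (.inr (ofReal_ne_top (r := C)))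
    rw [mul_zero] at hlim
    refine tendsto_of_tendsto_of_tendsto_of_le_of_le tendsto_const_nhds hlim (fun _ => zero_le)
      fun n => ?_
    rw [← lintegral_const_mul' _ _ ofReal_ne_top]
    exact lintegral_mono fun x => enorm_intervalIntegral_sub_le hg hgC c _ _
  · refine (tendsto_lintegral_enorm_smul_sub_smul
      (fun n => (hg.comp (hf n).continuous).aestronglyMeasurable) (fun n x => hgC (f n x))
      (hfu.mono fun x hx => (hg.tendsto _).comp hx) hG hfG).congr fun n => ?_
    simp_rw [Function.comp_def,
      gradient_intervalIntegral hg c ((hf n).differentiable one_ne_zero _)]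

theorem HasWeakGradientOn.comp_intervalIntegral_of_tendsto (h : HasWeakGradientOn u G Ω)
    (hΩ : IsOpen Ω) {g : ℕ → ℝ → ℝ} {b : ℝ → ℝ} (hg : ∀ n, Continuous (g n)) {C : ℝ}
    (hgC : ∀ n s, ‖g n s‖ ≤ C) (hgb : ∀ s, Tendsto (fun n => g n s) atTop (𝓝 (b s))) (c : ℝ) :
    HasWeakGradientOn (fun x => ∫ t in c..u x, b t) (fun x => b (u x) • G x) Ω := by
  refine hasWeakGradientOn_of_forall_isCompact hΩ fun K hKΩ hK => ?_
  have : IsFiniteMeasure (volume.restrict K) := ⟨by simpa using hK.measure_lt_top⟩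
  have hu : IntegrableOn u K := h.1.integrableOn_compact_subset hKΩ hK
  have hG : IntegrableOn G K := h.2.1.integrableOn_compact_subset hKΩ hK
  have hbC : ∀ s, ‖b s‖ ≤ C := fun s => le_of_tendsto' (hgb s).norm fun n => hgC n s
  have hbm : StronglyMeasurable b :=
    stronglyMeasurable_of_tendsto atTop (fun n => (hg n).stronglyMeasurable) (tendsto_pi_nhds.2 hgb)
  have hΨ : ∀ s, Tendsto (fun n => ∫ t in c..s, g n t) atTop (𝓝 (∫ t in c..s, b t)) := fun s =>
    intervalIntegral.tendsto_integral_filter_of_dominated_convergence (fun _ => C)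
      (.of_forall fun n => (hg n).aestronglyMeasurable)
      (.of_forall fun n => .of_forall fun t _ => hgC n t) intervalIntegrable_const
      (.of_forall fun t _ => hgb t)
  have hΨm : ∀ n, AEStronglyMeasurable (fun x => ∫ t in c..u x, g n t) (volume.restrict K) :=
    fun n => (contDiff_one_intervalIntegral (hg n) c).continuous.comp_aestronglyMeasurable hu.1
  have hbound : Integrable (fun x => C * ‖u x - c‖) (volume.restrict K) :=
    (hu.sub (integrable_const c)).norm.const_mul C
  refine .of_tendsto_L1 hK (fun n => (h.comp_intervalIntegral hΩ (hg n) (hgC n) c).mono hKΩ)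
    (hbound.mono' (aestronglyMeasurable_of_tendsto_ae atTop hΨm (.of_forall fun x => hΨ _))
      (.of_forall fun x => intervalIntegral.norm_integral_le_of_norm_le_const fun t _ => hbC t))
    (hG.bdd_smul C (hbm.aestronglyMeasurable.comp_aemeasurable hu.1.aemeasurable)
      (.of_forall fun x => hbC _)) ?_ ?_
  · simp_rw [← ofReal_norm]
    exact tendsto_lintegral_norm_of_dominated_convergence hΨm hbound.2
      (fun n => .of_forall fun x =>
        intervalIntegral.norm_integral_le_of_norm_le_const fun t _ => hgC n t)
      (.of_forall fun x => hΨ _)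
  · exact tendsto_lintegral_enorm_smul_sub_smul
      (fun n => (hg n).comp_aestronglyMeasurable hu.1) (fun n x => hgC n (u x))
      (.of_forall fun x => hgb _) hG (by simp)

theorem exists_continuous_tendsto_indicator {X : Type*} [TopologicalSpace X]
    [HasOuterApproxClosed X] {U : Set X} (hU : IsOpen U) :
    ∃ g : ℕ → X → ℝ, (∀ n, Continuous (g n)) ∧ (∀ n x, ‖g n x‖ ≤ 1) ∧
      ∀ x, Tendsto (fun n => g n x) atTop (𝓝 (U.indicator 1 x)) := by
  have hF : IsClosed Uᶜ := hU.isClosed_compl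
  refine ⟨fun n x => 1 - hF.apprSeq n x, fun n => by fun_prop, fun n x => ?_, fun x => ?_⟩
  · have : (hF.apprSeq n x : ℝ) ≤ 1 := mod_cast HasOuterApproxClosed.apprSeq_apply_le_one hF n x
    rw [Real.norm_of_nonneg (sub_nonneg.2 this)]
    exact sub_le_self _ (NNReal.coe_nonneg _)
  · have := (NNReal.tendsto_coe.2 (tendsto_pi_nhds.1
      (HasOuterApproxClosed.tendsto_apprSeq hF) x)).const_sub 1
    convert this using 2
    by_cases hx : x ∈ U <;> simp [hx]

theorem HasWeakGradientOn.comp_intervalIntegral_indicator (h : HasWeakGradientOn u G Ω)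
    (hΩ : IsOpen Ω) {U : Set ℝ} (hU : IsOpen U) (c : ℝ) :
    HasWeakGradientOn (fun x => ∫ t in c..u x, U.indicator 1 t) ((u ⁻¹' U).indicator G) Ω := by
  obtain ⟨g, hg, hg1, hgU⟩ := exists_continuous_tendsto_indicator hU
  convert h.comp_intervalIntegral_of_tendsto hΩ hg hg1 hgU c using 1
  ext1 x
  by_cases hx : u x ∈ U <;> simp [hx]

theorem intervalIntegral_indicator_one_of_le {U : Set ℝ} (hU : MeasurableSet U) {c s : ℝ}
    (hcs : c ≤ s) : ∫ t in c..s, U.indicator 1 t = volume.real (U ∩ Set.Ioc c s) := by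
  rw [intervalIntegral.integral_of_le hcs, integral_indicator_one hU, measureReal_restrict_apply hU]

theorem intervalIntegral_indicator_one_of_ge {U : Set ℝ} {c s : ℝ} (hU : U ⊆ Set.Ioi c)
    (hsc : s ≤ c) : ∫ t in c..s, U.indicator (1 : ℝ → ℝ) t = 0 := by
  rw [intervalIntegral.integral_of_ge hsc, neg_eq_zero]
  exact setIntegral_eq_zero_of_forall_eq_zero fun t ht =>
    Set.indicator_of_notMem (fun htU => ht.2.not_gt (hU htU)) _

theorem HasWeakGradientOn.max_sub_zero (h : HasWeakGradientOn u G Ω) (hΩ : IsOpen Ω) (k : ℝ) :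
    HasWeakGradientOn (fun x => max (u x - k) 0) ((u ⁻¹' Set.Ioi k).indicator G) Ω := by
  convert h.comp_intervalIntegral_indicator hΩ (isOpen_Ioi (a := k)) k using 2 with x
  rcases le_total k (u x) with hx | hx
  · rw [intervalIntegral_indicator_one_of_le measurableSet_Ioi hx,
      Set.inter_eq_right.2 fun t ht => ht.1, Real.volume_real_Ioc]
  · rw [intervalIntegral_indicator_one_of_ge subset_rfl hx, max_eq_right (sub_nonpos.2 hx)]

theorem HasWeakGradientOn.ae_eq {H : EuclideanSpace ℝ (Fin d) → EuclideanSpace ℝ (Fin d)}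
    (hG : HasWeakGradientOn u G Ω) (hH : HasWeakGradientOn u H Ω) (hΩ : IsOpen Ω) :
    G =ᵐ[volume.restrict Ω] H := by
  have hcoord : ∀ i, ∀ᵐ x, x ∈ Ω → G x i - H x i = 0 := fun i => by
    have hloc : ∀ {F : EuclideanSpace ℝ (Fin d) → EuclideanSpace ℝ (Fin d)},
        LocallyIntegrableOn F Ω → LocallyIntegrableOn (fun x => F x i) Ω := fun hF x hx =>
      (hF x hx).imp fun s hs => ⟨hs.1, (EuclideanSpace.proj (𝕜 := ℝ) i).integrable_comp hs.2⟩
    refine hΩ.ae_eq_zero_of_integral_contDiff_smul_eq_zero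
      ((hloc hG.2.1).sub (hloc hH.2.1)) fun φ hφ hφc hφΩ => ?_
    have hint : ∀ {F : EuclideanSpace ℝ (Fin d) → EuclideanSpace ℝ (Fin d)},
        LocallyIntegrableOn F Ω → Integrable fun x => F x i * φ x := fun hF =>
      (integrableOn_iff_integrable_of_support_subset
        ((Function.support_mul_subset_right _ _).trans (subset_tsupport φ))).1
        (((hloc hF).integrableOn_compact_subset hφΩ hφc).mul_continuousOn
          hφ.continuous.continuousOn hφc)
    have hGH := (hG.2.2 φ hφ hφc hφΩ i).symm.trans (hH.2.2 φ hφ hφc hφΩ i)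
    rw [neg_inj, setIntegral_mul_eq_integral_of_tsupport_subset hφΩ,
      setIntegral_mul_eq_integral_of_tsupport_subset hφΩ,
      ← sub_eq_zero, ← integral_sub (hint hG.2.1) (hint hH.2.1)] at hGH
    simpa only [smul_eq_mul, mul_comm, mul_sub] using hGH
  rw [Filter.EventuallyEq, ae_restrict_iff' hΩ.measurableSet]
  filter_upwards [ae_all_iff.2 hcoord] with x hx hxΩ
  ext i
  exact sub_eq_zero.1 (hx i hxΩ)

end Truncation

section LevelSets

open Filter Topology ENNReal Metric Set Gradient

variable {d : ℕ} [NeZero d] {u : EuclideanSpace ℝ (Fin d) → ℝ}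
  {G : EuclideanSpace ℝ (Fin d) → EuclideanSpace ℝ (Fin d)} {R : ℝ}

theorem HasWeakGradientOn.lintegral_ball_prod_enorm_sub_le_of_lt
    (h : HasWeakGradientOn u G (ball 0 R)) {r : ℝ} (hr : 0 < r) (hrR : r < R) :
    ∫⁻ p in ball 0 r ×ˢ ball 0 r, ‖u p.2 - u p.1‖ₑ ∂volume.prod volume
      ≤ ENNReal.ofReal (2 * r) * volume (ball (0 : EuclideanSpace ℝ (Fin d)) r)
        * ∫⁻ x in ball 0 r, ‖G x‖ₑ := by
  obtain ⟨f, hf, hfu, -, hfG⟩ := h.exists_contDiff_tendsto isOpen_ball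
    (isCompact_closedBall 0 r) (closedBall_subset_ball hrR)
  have hG : IntegrableOn G (ball 0 r) :=
    (h.2.1.integrableOn_compact_subset (closedBall_subset_ball hrR)
      (isCompact_closedBall 0 r)).mono_set ball_subset_closedBall
  rw [← Measure.prod_restrict]
  replace hfu := ae_restrict_of_ae_restrict_of_subset ball_subset_closedBall hfu
  set μ := volume.restrict (ball (0 : EuclideanSpace ℝ (Fin d)) r) with hμ
  set C := ENNReal.ofReal (2 * r) * volume (ball (0 : EuclideanSpace ℝ (Fin d)) r)
  have hC : C ≠ ⊤ := mul_ne_top ofReal_ne_top measure_ball_lt_top.ne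
  have hfG' : Tendsto (fun n => ∫⁻ x, ‖∇ (f n) x - G x‖ₑ ∂μ) atTop (𝓝 0) :=
    tendsto_of_tendsto_of_tendsto_of_le_of_le tendsto_const_nhds hfG (fun _ => zero_le)
      fun n => lintegral_mono_set ball_subset_closedBall
  have hlim := ENNReal.Tendsto.const_mul (hfG'.add_const (∫⁻ x, ‖G x‖ₑ ∂μ)) (.inr hC)
  rw [zero_add] at hlim
  have hbound : ∀ n, ∫⁻ p, ‖f n p.2 - f n p.1‖ₑ ∂μ.prod μ
      ≤ C * (∫⁻ x, ‖∇ (f n) x - G x‖ₑ ∂μ + ∫⁻ x, ‖G x‖ₑ ∂μ) := fun n => by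
    rw [hμ, Measure.prod_restrict]
    refine (lintegral_ball_prod_enorm_sub_le (hf n) hr).trans (mul_le_mul_right ?_ _)
    rw [← lintegral_add_right' _ hG.1.enorm]
    refine lintegral_mono fun x => ?_
    calc ‖fderiv ℝ (f n) x‖ₑ = ‖(∇ (f n) x - G x) + G x‖ₑ := by
          rw [sub_add_cancel, ← ofReal_norm, ← ofReal_norm, gradient, LinearIsometryEquiv.norm_map]
      _ ≤ _ := enorm_add_le _ _
  calc ∫⁻ p, ‖u p.2 - u p.1‖ₑ ∂μ.prod μ
      = ∫⁻ p, liminf (fun n => ‖f n p.2 - f n p.1‖ₑ) atTop ∂μ.prod μ := by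
        refine lintegral_congr_ae ?_
        filter_upwards [Measure.quasiMeasurePreserving_fst.ae hfu,
          Measure.quasiMeasurePreserving_snd.ae hfu] with p h1 h2
        exact ((h2.sub h1).enorm.liminf_eq).symm
    _ ≤ liminf (fun n => ∫⁻ p, ‖f n p.2 - f n p.1‖ₑ ∂μ.prod μ) atTop :=
        lintegral_liminf_le fun n => by
          have := (hf n).continuous.measurable
          fun_prop
    _ ≤ C * ∫⁻ x, ‖G x‖ₑ ∂μ :=
        (liminf_le_liminf (.of_forall hbound)).trans_eq hlim.liminf_eq

theorem HasWeakGradientOn.lintegral_ball_prod_enorm_sub_le (h : HasWeakGradientOn u G (ball 0 R)) :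
    ∫⁻ p in ball 0 R ×ˢ ball 0 R, ‖u p.2 - u p.1‖ₑ ∂volume.prod volume
      ≤ ENNReal.ofReal (2 * R) * volume (ball (0 : EuclideanSpace ℝ (Fin d)) R)
        * ∫⁻ x in ball 0 R, ‖G x‖ₑ := by
  obtain ⟨r, hr, hrR, hrt⟩ := exists_seq_strictMono_tendsto R
  have hmono : Monotone fun n => ball (0 : EuclideanSpace ℝ (Fin d)) (r n) := fun m n hmn =>
    ball_subset_ball (hr.monotone hmn)
  have hball : ball (0 : EuclideanSpace ℝ (Fin d)) R = ⋃ n, ball 0 (r n) := by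
    ext x
    simp only [mem_iUnion, mem_ball_zero_iff]
    exact ⟨fun hx => (hrt.eventually_const_lt hx).exists, fun ⟨n, hx⟩ => hx.trans (hrR n)⟩
  have hU : ball (0 : EuclideanSpace ℝ (Fin d)) R ×ˢ ball (0 : EuclideanSpace ℝ (Fin d)) R =
      ⋃ n, ball 0 (r n) ×ˢ ball 0 (r n) := by
    rw [iUnion_prod_of_monotone hmono hmono, ← hball]
  rw [hU, setLIntegral_iUnion_of_directed _ (hmono.set_prod hmono).directed_le]
  refine iSup_le fun n => ?_
  rcases le_or_gt (r n) 0 with hn | hn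
  · simp [ball_eq_empty.2 hn]
  refine (h.lintegral_ball_prod_enorm_sub_le_of_lt hn (hrR n)).trans ?_
  have := ball_subset_ball (x := (0 : EuclideanSpace ℝ (Fin d))) (hrR n).le
  gcongr
  exact (hrR n).le

theorem two_mul_mul_measure_level_sets_le_lintegral {X : Type*} [MeasurableSpace X] {μ : Measure X}
    [SFinite μ] {f : X → ℝ} (hf : AEMeasurable f μ) {a b : ℝ} (hab : a < b) :
    2 * (ENNReal.ofReal (b - a) * μ {x | f x ≤ a} * μ {x | b ≤ f x})
      ≤ ∫⁻ p, ‖f p.2 - f p.1‖ₑ ∂μ.prod μ := by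
  set A := {x | f x ≤ a}
  set B := {x | b ≤ f x}
  have hA : NullMeasurableSet A μ := hf.nullMeasurableSet_preimage measurableSet_Iic
  have hB : NullMeasurableSet B μ := hf.nullMeasurableSet_preimage measurableSet_Ici
  have hdisj : Disjoint (A ×ˢ B) (B ×ˢ A) := Set.disjoint_left.2 fun p hp hp' =>
    hab.not_ge ((show b ≤ f p.1 from hp'.1).trans hp.1)
  have hsub : A ×ˢ B ∪ B ×ˢ A ⊆ {p | ENNReal.ofReal (b - a) ≤ ‖f p.2 - f p.1‖ₑ} := by
    rintro p (⟨h1, h2⟩ | ⟨h1, h2⟩)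
    all_goals
      simp only [A, B, mem_ofPred_eq] at h1 h2 ⊢
      rw [← ofReal_norm, Real.norm_eq_abs]
      refine ofReal_le_ofReal (le_abs.2 ?_)
    · exact .inl (by linarith)
    · exact .inr (by linarith)
  calc 2 * (ENNReal.ofReal (b - a) * μ A * μ B)
      = ENNReal.ofReal (b - a) * (μ.prod μ) (A ×ˢ B ∪ B ×ˢ A) := by
        rw [measure_union₀ (hB.prod hA) hdisj.aedisjoint, Measure.prod_prod, Measure.prod_prod]
        ring
    _ ≤ ENNReal.ofReal (b - a) * (μ.prod μ) {p | ENNReal.ofReal (b - a) ≤ ‖f p.2 - f p.1‖ₑ} := by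
        gcongr
    _ ≤ _ := mul_meas_ge_le_lintegral₀ (hf.comp_snd.sub hf.comp_fst).enorm _

theorem HasWeakGradientOn.mul_volume_level_sets_le (h : HasWeakGradientOn u G (ball 0 R)) {k l : ℝ}
    (hkl : k < l) :
    ENNReal.ofReal (l - k) * volume ({x | u x ≤ k} ∩ ball 0 R) * volume ({x | l ≤ u x} ∩ ball 0 R)
      ≤ ENNReal.ofReal R * volume (ball (0 : EuclideanSpace ℝ (Fin d)) R) *
        ∫⁻ x in ball 0 R, ‖(u ⁻¹' Ioo k l).indicator G x‖ₑ := by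
  have hw := h.comp_intervalIntegral_indicator isOpen_ball (isOpen_Ioo (a := k) (b := l)) k
  set w := fun x => ∫ t in k..u x, (Ioo k l).indicator (1 : ℝ → ℝ) t
  have hlow : {x | u x ≤ k} ⊆ {x | w x ≤ 0} := fun x hx =>
    (intervalIntegral_indicator_one_of_ge Ioo_subset_Ioi_self hx).le
  have hhigh : {x | l ≤ u x} ⊆ {x | l - k ≤ w x} := fun x (hx : l ≤ u x) => by
    change l - k ≤ ∫ t in k..u x, _
    have hsub : Ioo k l ⊆ Ioc k (u x) := fun t ht => ⟨ht.1, ht.2.le.trans hx⟩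
    rw [intervalIntegral_indicator_one_of_le measurableSet_Ioo (hkl.le.trans hx),
      inter_eq_left.2 hsub, Real.volume_real_Ioo_of_le hkl.le]
  have hmain := hw.lintegral_ball_prod_enorm_sub_le
  rw [← Measure.prod_restrict] at hmain
  replace hmain := (two_mul_mul_measure_level_sets_le_lintegral
    hw.1.aestronglyMeasurable.aemeasurable (sub_pos.2 hkl)).trans hmain
  rw [sub_zero, ofReal_mul zero_le_two, ofReal_ofNat, mul_assoc 2, mul_assoc 2,
    ENNReal.mul_le_mul_iff_right two_ne_zero ofNat_ne_top,
    Measure.restrict_apply' measurableSet_ball, Measure.restrict_apply' measurableSet_ball] at hmain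
  refine le_trans ?_ hmain
  gcongr

end LevelSets

section Energy

open Filter ENNReal Metric Set

theorem MemH1.max_sub_zero {d : ℕ} {Ω : Set (EuclideanSpace ℝ (Fin d))}
    {u : EuclideanSpace ℝ (Fin d) → ℝ} (hu : MemH1 u Ω) (hΩ : IsOpen Ω) (hΩ' : volume Ω ≠ ⊤)
    (k : ℝ) : MemH1 (fun x => max (u x - k) 0) Ω := by
  obtain ⟨hu2, G, hG, hG2⟩ := hu
  have := isFiniteMeasure_restrict.2 hΩ'
  have hw := hG.max_sub_zero hΩ k
  refine ⟨(hu2.sub (memLp_const k)).mono hw.1.aestronglyMeasurable (.of_forall fun x => ?_), _, hw,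
    hG2.mono hw.2.1.aestronglyMeasurable (.of_forall fun x => norm_indicator_le_norm_self _ _)⟩
  rw [Real.norm_eq_abs, abs_of_nonneg (le_max_right _ _)]
  exact max_le (le_abs_self _) (norm_nonneg _)

theorem lintegral_enorm_indicator_le_rpow_mul_sqrt {α F : Type*} [MeasurableSpace α]
    [NormedAddCommGroup F] {μ : Measure α} {G : α → F} (hG : MemLp G 2 μ) {S : Set α}
    (hS : NullMeasurableSet S μ) :
    ∫⁻ x, ‖S.indicator G x‖ₑ ∂μ ≤ μ S ^ (1 / 2 : ℝ) * ENNReal.ofReal √(∫ x, ‖G x‖ ^ 2 ∂μ) := by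
  have hL2 : (∫⁻ x, ‖G x‖ₑ ^ (2 : ℝ) ∂μ) ^ (1 / 2 : ℝ) = ENNReal.ofReal √(∫ x, ‖G x‖ ^ 2 ∂μ) := by
    rw [Real.sqrt_eq_rpow, ← ofReal_rpow_of_nonneg (integral_nonneg fun x => sq_nonneg _)
      (by norm_num), ofReal_integral_eq_lintegral_ofReal
      ((memLp_two_iff_integrable_sq_norm hG.aestronglyMeasurable).1 hG)
      (.of_forall fun x => sq_nonneg _)]
    simp only [ofReal_pow (norm_nonneg _), ofReal_norm, ENNReal.rpow_ofNat]
  calc ∫⁻ x, ‖S.indicator G x‖ₑ ∂μ = ∫⁻ x in S, 1 * ‖G x‖ₑ ∂μ := by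
        simp only [enorm_indicator_eq_indicator_enorm, lintegral_indicator₀ hS, one_mul]
    _ ≤ (∫⁻ _ in S, 1 ^ (2 : ℝ) ∂μ) ^ (1 / 2 : ℝ) *
        (∫⁻ x in S, ‖G x‖ₑ ^ (2 : ℝ) ∂μ) ^ (1 / 2 : ℝ) :=
      lintegral_mul_le_Lp_mul_Lq _ .two_two aemeasurable_const
        hG.aestronglyMeasurable.enorm.restrict
    _ ≤ μ S ^ (1 / 2 : ℝ) * (∫⁻ x, ‖G x‖ₑ ^ (2 : ℝ) ∂μ) ^ (1 / 2 : ℝ) := by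
      rw [one_rpow, setLIntegral_one]
      gcongr
      exact Measure.restrict_le_self
    _ = _ := by rw [hL2]

theorem HasWeakGradientOn.mul_volume_real_level_sets_le {d : ℕ} [NeZero d]
    {u : EuclideanSpace ℝ (Fin d) → ℝ} {G : EuclideanSpace ℝ (Fin d) → EuclideanSpace ℝ (Fin d)}
    {R : ℝ} (h : HasWeakGradientOn u G (ball 0 R)) (hG : MemLp G 2 (volume.restrict (ball 0 R)))
    (hR : 0 ≤ R) {k l : ℝ} (hkl : k < l) :
    (l - k) * volume.real ({x | u x ≤ k} ∩ ball 0 R) * volume.real ({x | l ≤ u x} ∩ ball 0 R)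
      ≤ R * volume.real (ball (0 : EuclideanSpace ℝ (Fin d)) R)
        * volume.real (u ⁻¹' Ioo k l ∩ ball 0 R) ^ (1 / 2 : ℝ)
        * √(∫ x in ball 0 R, ‖(u ⁻¹' Ioi k).indicator G x‖ ^ 2) := by
  have hS : ∀ {T : Set ℝ}, MeasurableSet T →
      NullMeasurableSet (u ⁻¹' T) (volume.restrict (ball 0 R)) := fun hT =>
    h.1.aestronglyMeasurable.aemeasurable.nullMeasurableSet_preimage hT
  have hind : (u ⁻¹' Ioo k l).indicator ((u ⁻¹' Ioi k).indicator G)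
      = (u ⁻¹' Ioo k l).indicator G := by
    rw [indicator_indicator, inter_eq_left.2 (preimage_mono Ioo_subset_Ioi_self)]
  have hGk : MemLp ((u ⁻¹' Ioi k).indicator G) 2 (volume.restrict (ball 0 R)) :=
    hG.mono (hG.1.indicator₀ (hS measurableSet_Ioi))
      (.of_forall fun x => norm_indicator_le_norm_self _ _)
  have hCS := lintegral_enorm_indicator_le_rpow_mul_sqrt hGk
    (hS (measurableSet_Ioo (a := k) (b := l)))
  rw [hind, Measure.restrict_apply' measurableSet_ball] at hCS
  have hball : volume (ball (0 : EuclideanSpace ℝ (Fin d)) R) ≠ ⊤ := measure_ball_lt_top.ne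
  have hfin : volume (u ⁻¹' Ioo k l ∩ ball 0 R) ≠ ⊤ :=
    measure_ne_top_of_subset inter_subset_right hball
  have hreal := toReal_mono (by finiteness)
    ((h.mul_volume_level_sets_le hkl).trans (mul_le_mul_right hCS _))
  simpa only [measureReal_def, toReal_mul, toReal_ofReal (sub_pos.2 hkl).le, toReal_ofReal hR,
    toReal_ofReal (Real.sqrt_nonneg _), ← toReal_rpow, ← mul_assoc] using hreal

end Energy

theorem lemma4p1 {d : ℕ} (hd : 0 < d) (R : ℝ) (hR : 0 < R)
    (u : EuclideanSpace ℝ (Fin d) → ℝ)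
    (hu : MemH1 u (Metric.ball (0 : EuclideanSpace ℝ (Fin d)) R))
    (k l : ℝ) (hkl : k ≤ l) :
    MemH1 (fun x => max (u x - k) 0) (Metric.ball (0 : EuclideanSpace ℝ (Fin d)) R) ∧
    ∀ G : EuclideanSpace ℝ (Fin d) → EuclideanSpace ℝ (Fin d),
      HasWeakGradientOn (fun x => max (u x - k) 0) G
          (Metric.ball (0 : EuclideanSpace ℝ (Fin d)) R) →
        (l - k) *
            volume.real ({x | u x ≤ k} ∩ Metric.ball (0 : EuclideanSpace ℝ (Fin d)) R) *
            volume.real ({x | l ≤ u x} ∩ Metric.ball (0 : EuclideanSpace ℝ (Fin d)) R) ≤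
          R * volume.real (Metric.ball (0 : EuclideanSpace ℝ (Fin d)) R) *
            volume.real
              ({x | k < u x ∧ u x < l} ∩ Metric.ball (0 : EuclideanSpace ℝ (Fin d)) R)
                ^ (1 / 2 : ℝ) *
            Real.sqrt
              (∫ x in Metric.ball (0 : EuclideanSpace ℝ (Fin d)) R, ‖G x‖ ^ 2) := by
  have : NeZero d := ⟨hd.ne'⟩
  refine ⟨hu.max_sub_zero Metric.isOpen_ball measure_ball_lt_top.ne k, fun G hG => ?_⟩
  rcases hkl.eq_or_lt with rfl | hlt
  · rw [sub_self, zero_mul, zero_mul]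
    positivity
  obtain ⟨-, Gu, hGu, hGu2⟩ := hu
  have hGae := hG.ae_eq (hGu.max_sub_zero Metric.isOpen_ball k) Metric.isOpen_ball
  have hnorm := integral_congr_ae (hGae.fun_comp fun v => ‖v‖ ^ 2)
  simp only [Function.comp_apply] at hnorm
  rw [hnorm]
  exact hGu.mul_volume_real_level_sets_le hGu2 hR.le hlt
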